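/- All graphs are finite, simple and have at least one vertex. For an integer $k\ge 1$, an edge-colouring $\Gamma:E(G)\to\mathbb N$ of a graph $G$ (adjacent edges may have the same colour) is an $MC_k$-colouring if every two distinct vertices of $G$ are joined by at least $k$ pairwise edge-disjoint monochromatic paths, where a path is monochromatic if all its edges have the same colour, and different paths may have different colours. If $G$ has an $MC_k$-colouring, $mc_k(G)$ denotes the maximum number of colours used by an $MC_k$-colouring of $G$. A block of $G$ is a maximal connected subgraph of $G$ without a cut vertex of its own. Let $G$ be a $2$-edge-connected graph with $n$ vertices and $e(G)$ edges, and let $B_1,\dots,B_t$ be its distinct blocks. Then $G$ and each $B_i$ have an $MC_2$-colouring (so that $mc_2(G)$ and all $mc_2(B_i)$ are defined), $$mc_2(G)=\sum_{i=1}^{t}mc_2(B_i)-t+1,\qquad\text{and}\qquad mc_2(G)\le e(G)-n-t+2.$$ -/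

import Mathlib

namespace SimpleGraph

section MonochromaticEdgeConnection

variable {V : Type*} {G : SimpleGraph V}

/-- A walk in an edge-coloured graph is monochromatic if all of its edges have the same colour. -/
def Walk.IsMonochromatic {u v : V} (p : G.Walk u v) (Γ : G.edgeSet → ℕ) : Prop :=
  ∃ c : ℕ, ∀ (e : Sym2 V) (he : e ∈ p.edges), Γ ⟨e, p.edges_subset_edgeSet he⟩ = c

/-- An edge-colouring is an `MC_k`-colouring if any two distinct vertices are joined by `k`
pairwise edge-disjoint monochromatic paths (different paths may have different colours). -/
def IsMCColoring (k : ℕ) (Γ : G.edgeSet → ℕ) : Prop :=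
  ∀ u v : V, u ≠ v → ∃ P : Fin k → G.Path u v,
    (∀ i, (P i : G.Walk u v).IsMonochromatic Γ) ∧
    ∀ i j, i ≠ j → List.Disjoint (P i : G.Walk u v).edges (P j : G.Walk u v).edges

/-- The numbers of colours that are used by the `MC_k`-colourings of `G`. -/
def mcColorCounts (k : ℕ) (G : SimpleGraph V) : Set ℕ :=
  {m | ∃ Γ : G.edgeSet → ℕ, IsMCColoring k Γ ∧ (Set.range Γ).ncard = m}

/-- The monochromatic `k`-edge-connection number `mc_k(G)` of a finite graph `G`: the maximum
number of colours used by an `MC_k`-colouring of `G`. -/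
noncomputable def mc (k : ℕ) (G : SimpleGraph V) : ℕ :=
  sSup (mcColorCounts k G)

/-- For a finite graph, the supremum that defines `mc_k(G)` is a maximum as soon as `G` has an
`MC_k`-colouring at all. -/
theorem mc_isGreatest [Finite V] (k : ℕ) (G : SimpleGraph V)
    (h : (mcColorCounts k G).Nonempty) : IsGreatest (mcColorCounts k G) (mc k G) := by
  have hb : BddAbove (mcColorCounts k G) := by
    refine ⟨Nat.card G.edgeSet, ?_⟩
    rintro m ⟨Γ, -, rfl⟩
    rw [← Set.image_univ, ← Set.ncard_univ]
    exact Set.ncard_image_le Set.finite_univ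
  exact ⟨Nat.sSup_mem h hb, fun m hm => le_csSup hb hm⟩

/-- A subgraph is nonseparable if it is connected (hence nonempty) and has no cut vertex. -/
def Subgraph.IsNonseparable (H : G.Subgraph) : Prop :=
  H.Connected ∧ ∀ v ∈ H.verts, (H.deleteVerts {v}).Preconnected

/-- A block of `G` is a maximal nonseparable subgraph of `G`. -/
def Subgraph.IsBlock (H : G.Subgraph) : Prop :=
  Maximal Subgraph.IsNonseparable H

end MonochromaticEdgeConnection

end SimpleGraph

/-!
Write `s(G)` for the minimum number of edges of a `2`-edge-connected spanning subgraph of `G`. For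
`|V| ≥ 2`, everything follows from `mc_2(G) = e(G) - s(G) + 1`: a spanning subgraph is
`2`-edge-connected iff its part in every block is, so `e` and `s` are additive over blocks, and
`s(B_i) ≥ |B_i|` with `∑ |B_i| ≥ n + t - 1` gives the upper bound.

For `mc_2(G) ≥ e(G) - s(G) + 1`, give the edges of an optimal spanning subgraph one colour and all
other edges distinct colours.

For the converse, let `C_i` be the nontrivial components of the colour classes of an
`MC_2`-colouring. The number of colours is at most `e(G) - ∑ (e(C_i) - 1)`, so it suffices to find a
`2`-edge-connected spanning subgraph with at most `1 + ∑ (e(C_i) - 1)` edges. Let `C` be the `C_i`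
with the most vertices and delete its bridges. The resulting graph extends to a `2`-edge-connected
spanning subgraph of `G` by merging its `2`-edge-connected classes along cycles of classes. A cycle
of length `m` costs `m` edges and merges `m` classes, so a long first cycle, through the end of a
longest path of classes, saves edges in terms of the degree of a vertex `w` in that end class. The
remaining cost is paid by the other `C_i`: every vertex outside the class of `w` that is not a
neighbour of `w` is connected to `w` within two of the `C_i`, or `2`-edge-reachable within one.
-/

namespace MonochromaticConnection

open SimpleGraph

section TwoEdgeClasses

variable {V : Type*} {G H K : SimpleGraph V}

/-- The equivalence relation of being `2`-edge-reachable in `H`. -/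
def twoEdgeSetoid (H : SimpleGraph V) : Setoid V where
  r := H.IsEdgeReachable 2
  iseqv := ⟨fun _ => .rfl, fun h => h.symm, fun h h' => h.trans h'⟩

/-- The `2`-edge-connected classes of `H`: the vertex sets of the components that remain when all
bridges of `H` are removed. -/
abbrev TwoEdgeClass (H : SimpleGraph V) : Type _ := Quotient (twoEdgeSetoid H)

/-- The `2`-edge-connected class of a vertex. -/
def twoEdgeClass (H : SimpleGraph V) (v : V) : TwoEdgeClass H := Quotient.mk _ v

theorem twoEdgeClass_eq_iff {x y : V} :
    twoEdgeClass H x = twoEdgeClass H y ↔ H.IsEdgeReachable 2 x y :=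
  Quotient.eq (r := twoEdgeSetoid H)

theorem twoEdgeClass_surjective (H : SimpleGraph V) : Function.Surjective (twoEdgeClass H) :=
  Quotient.exists_rep

/-- The simple graph that `G` induces on the `2`-edge-connected classes of `H`. -/
def classGraph (G H : SimpleGraph V) : SimpleGraph (TwoEdgeClass H) :=
  G.map (twoEdgeClass H)

theorem classGraph_adj {a b : TwoEdgeClass H} :
    (classGraph G H).Adj a b ↔
      a ≠ b ∧ ∃ u v, G.Adj u v ∧ twoEdgeClass H u = a ∧ twoEdgeClass H v = b :=
  Iff.rfl

theorem classGraph_reachable {x y : V} (h : G.Reachable x y) :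
    (classGraph G H).Reachable (twoEdgeClass H x) (twoEdgeClass H y) := by
  obtain ⟨p⟩ := h
  induction p with
  | nil => rfl
  | @cons x z y hxz _ ih =>
    by_cases hne : twoEdgeClass H x = twoEdgeClass H z
    · rwa [hne]
    · exact (classGraph_adj.2 ⟨hne, x, z, hxz, rfl, rfl⟩).reachable.trans ih

theorem classGraph_deleteEdges_le (u v : V) :
    (classGraph G H).deleteEdges {s(twoEdgeClass H u, twoEdgeClass H v)} ≤
      classGraph (G.deleteEdges {s(u, v)}) H := by
  intro a b hab
  rw [deleteEdges_adj] at hab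
  obtain ⟨⟨hne, x, y, hxy, rfl, rfl⟩, huv⟩ := hab
  refine ⟨hne, x, y, deleteEdges_adj.2 ⟨hxy, fun h => huv ?_⟩, rfl, rfl⟩
  exact congrArg (Sym2.map (twoEdgeClass H)) h

theorem exists_mem_edgeSet_of_mem_edgeSet_classGraph {q : Sym2 (TwoEdgeClass H)}
    (hq : q ∈ (classGraph G H).edgeSet) :
    ∃ e ∈ G.edgeSet, e.map (twoEdgeClass H) = q := by
  induction q with
  | h a b =>
    obtain ⟨-, u, v, huv, rfl, rfl⟩ := hq
    exact ⟨s(u, v), huv, rfl⟩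

theorem reachable_of_walk_twoEdgeClass {D : SimpleGraph (TwoEdgeClass H)}
    (hK : ∀ u v, H.IsEdgeReachable 2 u v → K.Reachable u v)
    {a b : TwoEdgeClass H} (p : D.Walk a b)
    (hp : ∀ q ∈ p.edges, ∃ e ∈ K.edgeSet, e.map (twoEdgeClass H) = q) {x y : V}
    (hx : twoEdgeClass H x = a) (hy : twoEdgeClass H y = b) : K.Reachable x y := by
  induction p generalizing x with
  | nil => exact hK _ _ (twoEdgeClass_eq_iff.1 (hx.trans hy.symm))
  | @cons a c b _ p ih =>
    rw [Walk.edges_cons, List.forall_mem_cons] at hp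
    obtain ⟨u, v, huv, hu, hv⟩ : ∃ u v, K.Adj u v ∧ twoEdgeClass H u = a ∧
        twoEdgeClass H v = c := by
      obtain ⟨⟨e, he, heq⟩, -⟩ := hp
      induction e with
      | h u v =>
        rcases Sym2.eq_iff.1 heq with ⟨hu, hv⟩ | ⟨hu, hv⟩
        · exact ⟨u, v, he, hu, hv⟩
        · exact ⟨v, u, Adj.symm he, hv, hu⟩
    exact (hK _ _ (twoEdgeClass_eq_iff.1 (hx.trans hu.symm))).trans
      (huv.reachable.trans (ih hp.2 hv hy))

theorem card_twoEdgeClass_add_card_le [Finite V] (hHK : H ≤ K) {S : Finset (TwoEdgeClass H)}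
    (hne : S.Nonempty)
    (hS : ∀ x y, twoEdgeClass H x ∈ S → twoEdgeClass H y ∈ S → K.IsEdgeReachable 2 x y) :
    Nat.card (TwoEdgeClass K) + S.card ≤ Nat.card (TwoEdgeClass H) + 1 := by
  classical
  have := Fintype.ofFinite (TwoEdgeClass K)
  have := Fintype.ofFinite (TwoEdgeClass H)
  let f : TwoEdgeClass H → TwoEdgeClass K := Quotient.map' id fun _ _ h => h.mono hHK
  obtain ⟨s, hs⟩ := hne
  obtain ⟨s, rfl⟩ := twoEdgeClass_surjective H s
  have hsurj : (insert (twoEdgeClass H s) Sᶜ).image f = Finset.univ := by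
    refine Finset.eq_univ_of_forall fun z => Finset.mem_image.2 ?_
    obtain ⟨z, rfl⟩ := twoEdgeClass_surjective K z
    by_cases hz : twoEdgeClass H z ∈ S
    · exact ⟨_, Finset.mem_insert_self _ _, twoEdgeClass_eq_iff.2 (hS _ _ hs hz)⟩
    · exact ⟨twoEdgeClass H z, by simp [hz], rfl⟩
  have hcard : Fintype.card (TwoEdgeClass K) ≤ Sᶜ.card + 1 := by
    rw [← Finset.card_univ, ← hsurj]
    exact Finset.card_image_le.trans (Finset.card_insert_le _ _)
  rw [Nat.card_eq_fintype_card, Nat.card_eq_fintype_card]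
  have := Finset.card_add_card_compl S
  omega

theorem ncard_edgeSet_sup_fromEdgeSet_le (H : SimpleGraph V) (E : Set (Sym2 V)) [Finite V] :
    (H ⊔ fromEdgeSet E).edgeSet.ncard ≤ H.edgeSet.ncard + E.ncard := by
  refine (Set.ncard_le_ncard ?_ (Set.toFinite _)).trans (Set.ncard_union_le _ _)
  rw [edgeSet_sup, edgeSet_fromEdgeSet]
  exact Set.union_subset_union_right _ Set.sdiff_subset

theorem isEdgeReachable_two_of_mem_support (hHK : H ≤ K) {u v x : V} (huv : K.Adj u v)
    {D : SimpleGraph (TwoEdgeClass H)} {p : D.Walk (twoEdgeClass H u) (twoEdgeClass H v)}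
    (hp : p.IsTrail)
    (hpK : ∀ q ∈ p.edges, ∃ e ∈ K.edgeSet \ {s(u, v)}, e.map (twoEdgeClass H) = q)
    (hx : twoEdgeClass H x ∈ p.support) : K.IsEdgeReachable 2 u x := by
  classical
  refine isEdgeReachable_two.2 fun e => ?_
  have hH (a b : V) (hab : H.IsEdgeReachable 2 a b) : (K.deleteEdges {e}).Reachable a b :=
    isEdgeReachable_two.1 (hab.mono hHK) e
  by_cases he : e ≠ s(u, v) ∧ e.map (twoEdgeClass H) ∈ (p.takeUntil _ hx).edges
  · have huv' : (K.deleteEdges {e}).Adj u v := deleteEdges_adj.2 ⟨huv, he.1.symm⟩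
    refine huv'.reachable.trans (reachable_of_walk_twoEdgeClass hH (p.dropUntil _ hx)
      (fun q hq => ?_) rfl rfl).symm
    obtain ⟨f, hf, rfl⟩ := hpK q (p.edges_dropUntil_subset_edges hx hq)
    refine ⟨f, (edgeSet_deleteEdges _).symm ▸ ⟨hf.1, ?_⟩, rfl⟩
    rintro rfl
    have hnodup := hp.edges_nodup
    rw [← p.take_spec hx, Walk.edges_append] at hnodup
    exact List.disjoint_of_nodup_append hnodup he.2 hq
  · refine reachable_of_walk_twoEdgeClass hH (p.takeUntil _ hx) (fun q hq => ?_) rfl rfl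
    obtain ⟨f, hf, rfl⟩ := hpK q (p.edges_takeUntil_subset_edges hx hq)
    refine ⟨f, (edgeSet_deleteEdges _).symm ▸ ⟨hf.1, ?_⟩, rfl⟩
    rintro rfl
    exact he ⟨hf.2, hq⟩

theorem exists_merge_of_isPath [Finite V] (hHG : H ≤ G) {u v : V} (huv : G.Adj u v)
    {p : (classGraph (G.deleteEdges {s(u, v)}) H).Walk (twoEdgeClass H u) (twoEdgeClass H v)}
    (hp : p.IsPath) :
    ∃ K, H ≤ K ∧ K ≤ G ∧ K.edgeSet.ncard ≤ H.edgeSet.ncard + p.length + 1 ∧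
      Nat.card (TwoEdgeClass K) + p.length ≤ Nat.card (TwoEdgeClass H) := by
  classical
  have : Nonempty (Sym2 V) := ⟨s(u, v)⟩
  have hrep := fun q (hq : q ∈ p.edges) =>
    exists_mem_edgeSet_of_mem_edgeSet_classGraph (p.edges_subset_edgeSet hq)
  choose! rep hrep hrep_map using hrep
  rw [edgeSet_deleteEdges] at hrep
  set E : Set (Sym2 V) := rep '' {q | q ∈ p.edges} ∪ {s(u, v)}
  have hEG : E ⊆ G.edgeSet := by
    rintro _ (⟨q, hq, rfl⟩ | rfl)
    · exact (hrep q hq).1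
    · exact huv
  have hEcard : E.ncard ≤ p.length + 1 := by
    refine (Set.ncard_union_le _ _).trans (Nat.add_le_add ?_ (Set.ncard_singleton _).le)
    refine (Set.ncard_image_le (List.finite_toSet _)).trans ?_
    rw [← p.length_edges, ← List.coe_toFinset, Set.ncard_coe_finset]
    exact List.toFinset_card_le _
  set K := H ⊔ fromEdgeSet E
  have hHK : H ≤ K := le_sup_left
  have hEK : E ⊆ K.edgeSet := fun e he => by
    rw [edgeSet_sup, edgeSet_fromEdgeSet]
    exact Or.inr ⟨he, G.not_isDiag_of_mem_edgeSet (hEG he)⟩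
  have hreach (x : V) (hx : twoEdgeClass H x ∈ p.support) : K.IsEdgeReachable 2 u x :=
    isEdgeReachable_two_of_mem_support hHK (hEK (Or.inr rfl)) hp.isTrail
      (fun q hq => ⟨rep q, ⟨hEK (Or.inl ⟨q, hq, rfl⟩), (hrep q hq).2⟩, hrep_map q hq⟩) hx
  have hcl := card_twoEdgeClass_add_card_le hHK (S := p.support.toFinset)
    ⟨twoEdgeClass H u, by simp⟩ fun x y hx hy =>
      (hreach x (by simpa using hx)).symm.trans (hreach y (by simpa using hy))
  rw [List.toFinset_card_of_nodup hp.support_nodup, Walk.length_support] at hcl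
  have hKcard : K.edgeSet.ncard ≤ _ := ncard_edgeSet_sup_fromEdgeSet_le H E
  refine ⟨K, hHK, sup_le hHG ?_, by omega, by omega⟩
  rw [← edgeSet_subset_edgeSet, edgeSet_fromEdgeSet]
  exact Set.sdiff_subset.trans hEG

/-- `G - uv` still joins `u` to `v`, so an edge between two classes closes a cycle of classes (of
length two, possibly); merging `k + 1` classes with `k + 1 ≤ 2k` edges costs at most two edges per
class that disappears. -/
theorem exists_isEdgeConnected_two_between [Finite V] [Nonempty V] (hG : G.IsEdgeConnected 2)
    (hHG : H ≤ G) :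
    ∃ K, H ≤ K ∧ K ≤ G ∧ K.IsEdgeConnected 2 ∧
      K.edgeSet.ncard + 2 ≤ H.edgeSet.ncard + 2 * Nat.card (TwoEdgeClass H) := by
  induction hn : Nat.card (TwoEdgeClass H) using Nat.strong_induction_on generalizing H with
  | h n ih =>
    by_cases hH : ∀ u v, G.Adj u v → H.IsEdgeReachable 2 u v
    · refine ⟨H, le_rfl, hHG, fun x y => ?_, ?_⟩
      · obtain ⟨p⟩ := (hG x y).reachable two_ne_zero
        induction p with
        | nil => rfl
        | cons h _ ih => exact (hH _ _ h).trans ih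
      · have : Nonempty (TwoEdgeClass H) := ⟨twoEdgeClass H (Classical.arbitrary V)⟩
        have : 0 < Nat.card (TwoEdgeClass H) := Nat.card_pos
        omega
    · push Not at hH
      obtain ⟨u, v, huv, hne⟩ := hH
      obtain ⟨p, hp⟩ :=
        (classGraph_reachable (H := H) (isEdgeReachable_two.1 (hG u v) s(u, v))).exists_isPath
      have hlen : p.length ≠ 0 := fun h =>
        hne (twoEdgeClass_eq_iff.1 (Walk.eq_of_length_eq_zero h))
      obtain ⟨K, hHK, hKG, hcard, hclasses⟩ := exists_merge_of_isPath hHG huv hp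
      obtain ⟨L, hKL, hLG, hL, hLcard⟩ := ih _ (by omega) hKG rfl
      exact ⟨L, hHK.trans hKL, hLG, hL, by omega⟩

theorem exists_adj_getVert_ncard_neighborSet_le [Finite V] {b v : V} {p : G.Walk b v}
    (hne : (G.neighborSet b).Nonempty) (hp : G.neighborSet b ⊆ {x | x ∈ p.support}) :
    ∃ k ≤ p.length, G.Adj b (p.getVert k) ∧ (G.neighborSet b).ncard ≤ k := by
  classical
  have hpos (x : V) (hx : G.Adj b x) : ∃ i ∈ Finset.Icc 1 p.length, p.getVert i = x := by
    obtain ⟨i, rfl, hi⟩ := Walk.mem_support_iff_exists_getVert.1 (hp hx)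
    refine ⟨i, Finset.mem_Icc.2 ⟨Nat.one_le_iff_ne_zero.2 ?_, hi⟩, rfl⟩
    rintro rfl
    simp at hx
  obtain ⟨x₀, hx₀⟩ := hne
  obtain ⟨i₀, hi₀, rfl⟩ := hpos x₀ hx₀
  obtain ⟨k, hk, hkmax⟩ :=
    ((Finset.Icc 1 p.length).filter fun i => G.Adj b (p.getVert i)).exists_max_image id
      ⟨i₀, Finset.mem_filter.2 ⟨hi₀, hx₀⟩⟩
  rw [Finset.mem_filter, Finset.mem_Icc] at hk
  have hsub : G.neighborSet b ⊆ p.getVert '' (Finset.Icc 1 k : Finset ℕ) := by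
    intro x hx
    obtain ⟨i, hi, rfl⟩ := hpos x hx
    have := hkmax i (Finset.mem_filter.2 ⟨hi, hx⟩)
    exact ⟨i, by simpa using ⟨(Finset.mem_Icc.1 hi).1, this⟩, rfl⟩
  refine ⟨k, hk.1.2, hk.2, (Set.ncard_le_ncard hsub (Set.toFinite _)).trans ?_⟩
  refine (Set.ncard_image_le (Finset.finite_toSet _)).trans ?_
  simp

/-- Take an end `b` of a longest path and its neighbour farthest along that path. -/
theorem exists_vertex_isPath_deleteEdges [Finite V] [Nonempty V] (G : SimpleGraph V) :
    ∃ b, (G.neighborSet b).ncard ≤ 1 ∨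
      ∃ x, G.Adj b x ∧ ∃ p : (G.deleteEdges {s(b, x)}).Walk b x,
        p.IsPath ∧ (G.neighborSet b).ncard ≤ p.length := by
  obtain ⟨b, v, p, hp, hmax⟩ := Walk.exists_isPath_forall_isPath_length_le_length G
  refine ⟨b, or_iff_not_imp_left.2 fun hdeg => ?_⟩
  have hnbr : G.neighborSet b ⊆ {x | x ∈ p.support} := fun x (hx : G.Adj b x) => by
    by_contra hxp
    simpa using hmax _ _ (Walk.cons hx.symm p) (hp.cons hxp)
  obtain ⟨k, hk, hadj, hdegk⟩ := exists_adj_getVert_ncard_neighborSet_le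
    (Set.nonempty_of_ncard_ne_zero (by omega)) hnbr
  have hedge : s(b, p.getVert k) ∉ (p.take k).edges := fun h => by
    have hsnd : p.getVert k = p.getVert 1 := by
      rw [(hp.take k).eq_snd_of_mem_edges h, Walk.snd, Walk.take_getVert]
      congr 1
      omega
    have : k = 1 := hp.getVert_injOn (by simp; omega) (by simp; omega) hsnd
    omega
  refine ⟨_, hadj, (p.take k).toDeleteEdge _ hedge, (hp.take k).transfer _, ?_⟩
  rw [Walk.toDeleteEdge, Walk.toDeleteEdges, Walk.length_transfer, Walk.take_length]
  omega

theorem card_twoEdgeClass_le [Finite V] (w : V) :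
    Nat.card (TwoEdgeClass H) ≤ 1 + ((classGraph G H).neighborSet (twoEdgeClass H w)).ncard +
      {y | ¬ H.IsEdgeReachable 2 w y ∧ ¬ G.Adj w y}.ncard := by
  set N := (classGraph G H).neighborSet (twoEdgeClass H w)
  set Y := {y | ¬ H.IsEdgeReachable 2 w y ∧ ¬ G.Adj w y}
  have hcover : Set.univ ⊆ ({twoEdgeClass H w} ∪ N) ∪ twoEdgeClass H '' Y := by
    intro c _
    obtain ⟨y, rfl⟩ := twoEdgeClass_surjective H c
    by_cases h1 : twoEdgeClass H w = twoEdgeClass H y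
    · exact Or.inl (Or.inl h1.symm)
    by_cases h2 : G.Adj w y
    · exact Or.inl (Or.inr (classGraph_adj.2 ⟨h1, w, y, h2, rfl, rfl⟩))
    · exact Or.inr ⟨y, ⟨fun h => h1 (twoEdgeClass_eq_iff.2 h), h2⟩, rfl⟩
  rw [← Set.ncard_univ, ← Set.ncard_singleton (twoEdgeClass H w)]
  refine (Set.ncard_le_ncard hcover (Set.toFinite _)).trans ((Set.ncard_union_le _ _).trans ?_)
  exact Nat.add_le_add (Set.ncard_union_le _ _) (Set.ncard_image_le (Set.toFinite _))

theorem exists_isEdgeConnected_two_extension [Finite V] [Nonempty V] (hG : G.IsEdgeConnected 2)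
    (hHG : H ≤ G) :
    ∃ w₀, ∀ w, H.IsEdgeReachable 2 w₀ w → ∃ K, H ≤ K ∧ K ≤ G ∧ K.IsEdgeConnected 2 ∧
      K.edgeSet.ncard ≤ H.edgeSet.ncard + Nat.card (TwoEdgeClass H) +
        {y | ¬ H.IsEdgeReachable 2 w y ∧ ¬ G.Adj w y}.ncard := by
  have : Nonempty (TwoEdgeClass H) := ⟨twoEdgeClass H (Classical.arbitrary V)⟩
  obtain ⟨b, hb⟩ := exists_vertex_isPath_deleteEdges (classGraph G H)
  obtain ⟨w₀, hw₀⟩ := twoEdgeClass_surjective H b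
  refine ⟨w₀, fun w hw => ?_⟩
  have hclasses := card_twoEdgeClass_le (G := G) (H := H) w
  rw [← twoEdgeClass_eq_iff.2 hw, hw₀] at hclasses
  rcases hb with hdeg | ⟨_, ⟨-, u, v, huv, rfl, rfl⟩, p, hp, hdeg⟩
  · obtain ⟨K, hHK, hKG, hK, hcard⟩ := exists_isEdgeConnected_two_between hG hHG
    exact ⟨K, hHK, hKG, hK, by omega⟩
  · obtain ⟨K, hHK, hKG, hcard, hmerge⟩ :=
      exists_merge_of_isPath hHG huv (hp.mapLe (classGraph_deleteEdges_le u v))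
    obtain ⟨L, hKL, hLG, hL, hLcard⟩ := exists_isEdgeConnected_two_between hG hKG
    rw [Walk.length_map] at hcard hmerge
    exact ⟨L, hHK.trans hKL, hLG, hL, by omega⟩

end TwoEdgeClasses

theorem reachable_deleteEdges {V : Type*} {K : SimpleGraph V} {v w x z : V}
    (hvw : (K.deleteEdges {s(v, w)}).Reachable v w)
    (hxz : K.Reachable x z) : (K.deleteEdges {s(v, w)}).Reachable x z := by
  obtain ⟨p⟩ := hxz
  induction p with
  | nil => rfl
  | @cons a c _ hac _ ih =>
    refine Reachable.trans ?_ ih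
    by_cases he : s(a, c) = s(v, w)
    · rcases Sym2.eq_iff.1 he with ⟨rfl, rfl⟩ | ⟨rfl, rfl⟩
      exacts [hvw, hvw.symm]
    · exact Adj.reachable (deleteEdges_adj.2 ⟨hac, he⟩)

section EdgeCounts

variable {V : Type*} [Finite V] {K : SimpleGraph V} {u y : V}

theorem ncard_reachable_le (K : SimpleGraph V) (u : V) :
    {v | K.Reachable u v}.ncard ≤ K.edgeSet.ncard + 1 := by
  have hsupp : (K.connectedComponentMk u).supp = {v | K.Reachable u v} := by
    ext v
    rw [ConnectedComponent.mem_supp_iff, ConnectedComponent.eq, reachable_comm]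
    rfl
  have hedges : Nat.card (K.connectedComponentMk u).toSimpleGraph.edgeSet ≤ K.edgeSet.ncard :=
    Nat.card_le_card_of_injective _
      (Embedding.induce (K.connectedComponentMk u).supp).mapEdgeSet.injective
  rw [← hsupp, ← Nat.card_coe_set_eq]
  exact (K.connectedComponentMk u).connected_toSimpleGraph.card_vert_le_card_edgeSet_add_one.trans
    (Nat.add_le_add_right hedges 1)

theorem ncard_reachable_le_of_isEdgeReachable_two (hne : u ≠ y)
    (h : K.IsEdgeReachable 2 u y) : {v | K.Reachable u v}.ncard ≤ K.edgeSet.ncard := by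
  obtain ⟨w, hw, hw2⟩ := exists_adj_isEdgeReachable_two hne h
  have hsub : {v | K.Reachable u v} ⊆ {v | (K.deleteEdges {s(u, w)}).Reachable u v} :=
    fun v => reachable_deleteEdges (isEdgeReachable_two.1 hw2 s(u, w))
  have hle := (Set.ncard_le_ncard hsub (Set.toFinite _)).trans (ncard_reachable_le _ u)
  rw [edgeSet_deleteEdges] at hle
  have := Set.ncard_sdiff_singleton_add_one (K.mem_edgeSet.2 hw) (Set.toFinite _)
  omega

/-- One less than the number of edges of `K`, the number of colours that are lost when a colour
class is `K`. -/
noncomputable def edgeExcess (K : SimpleGraph V) : ℕ := K.edgeSet.ncard - 1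

theorem edgeExcess_add_one (hK : K ≠ ⊥) : edgeExcess K + 1 = K.edgeSet.ncard := by
  have := (Set.ncard_pos (Set.toFinite _)).2 (edgeSet_nonempty.2 hK)
  unfold edgeExcess
  omega

end EdgeCounts

section SupportFinset

variable {V : Type*} [Fintype V] {K : SimpleGraph V} {u v : V}

open scoped Classical in
/-- The support of `K` as a finset: for a graph without isolated vertices of its own, such as a
colour class, this is its vertex set. -/
noncomputable def supportFinset (K : SimpleGraph V) : Finset V := {v | v ∈ K.support}

theorem mem_supportFinset : v ∈ supportFinset K ↔ v ∈ K.support := by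
  simp [supportFinset]

theorem mem_supportFinset_of_adj (h : K.Adj u v) : u ∈ supportFinset K :=
  mem_supportFinset.2 ⟨v, h⟩

theorem mem_supportFinset_of_reachable (hne : u ≠ v) (h : K.Reachable u v) :
    u ∈ supportFinset K :=
  mem_supportFinset.2 (mem_support_of_reachable hne h)

end SupportFinset

section Joining

variable {V ι : Type*} [Fintype V] [Fintype ι] {C : ι → SimpleGraph V} {i : ι} {u v : V}

open scoped Classical in
/-- The members of a family of graphs that contain both `u` and `v`. -/
noncomputable def joining (C : ι → SimpleGraph V) (u v : V) : Finset ι :=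
  {i | u ∈ supportFinset (C i) ∧ v ∈ supportFinset (C i)}

theorem mem_joining :
    i ∈ joining C u v ↔ u ∈ supportFinset (C i) ∧ v ∈ supportFinset (C i) := by
  simp [joining]

theorem mem_joining_of_reachable (hne : u ≠ v) (h : (C i).Reachable u v) : i ∈ joining C u v :=
  mem_joining.2
    ⟨mem_supportFinset_of_reachable hne h, mem_supportFinset_of_reachable hne.symm h.symm⟩

end Joining

/-- A family of edge-disjoint connected nonempty subgraphs of `G` such that any two vertices are
`2`-edge-reachable in one of them or connected in two of them. The components of the colour classes
of an `MC_2`-colouring form such a family. -/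
structure IsColorFamily {V ι : Type*} (G : SimpleGraph V) (C : ι → SimpleGraph V) : Prop where
  le : ∀ i, C i ≤ G
  eq_of_adj : ∀ {i j u v}, (C i).Adj u v → (C j).Adj u v → i = j
  ne_bot : ∀ i, C i ≠ ⊥
  reachable : ∀ {i u v}, u ∈ (C i).support → v ∈ (C i).support → (C i).Reachable u v
  cover : ∀ {u v}, u ≠ v → (∃ i, (C i).IsEdgeReachable 2 u v) ∨
    ∃ i j, i ≠ j ∧ (C i).Reachable u v ∧ (C j).Reachable u v

namespace IsColorFamily

open Finset
open scoped Classical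

variable {V ι : Type*} [Fintype V] {G : SimpleGraph V} {C : ι → SimpleGraph V}

theorem coe_supportFinset (h : IsColorFamily G C) {i : ι} {u : V}
    (hu : u ∈ supportFinset (C i)) : (supportFinset (C i) : Set V) = {v | (C i).Reachable u v} := by
  ext v
  rw [mem_coe, mem_supportFinset]
  refine ⟨h.reachable (mem_supportFinset.1 hu), fun huv => ?_⟩
  rcases eq_or_ne v u with rfl | hne
  · exact mem_supportFinset.1 hu
  · exact mem_support_of_reachable hne huv.symm

theorem card_supportFinset_le (h : IsColorFamily G C) (i : ι) :
    #(supportFinset (C i)) ≤ edgeExcess (C i) + 2 := by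
  obtain ⟨u, v, huv⟩ := ne_bot_iff_exists_adj.1 (h.ne_bot i)
  have := ncard_reachable_le (C i) u
  have := edgeExcess_add_one (h.ne_bot i)
  rw [← Set.ncard_coe_finset, h.coe_supportFinset (mem_supportFinset_of_adj huv)]
  omega

theorem card_supportFinset_le_of_isEdgeReachable_two (h : IsColorFamily G C) {i : ι} {u y : V}
    (hne : u ≠ y) (h2 : (C i).IsEdgeReachable 2 u y) :
    #(supportFinset (C i)) ≤ edgeExcess (C i) + 1 := by
  have hu := mem_supportFinset_of_reachable hne (h2.reachable two_ne_zero)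
  rw [← Set.ncard_coe_finset, h.coe_supportFinset hu, edgeExcess_add_one (h.ne_bot i)]
  exact ncard_reachable_le_of_isEdgeReachable_two hne h2

theorem two_le_card_supportFinset (h : IsColorFamily G C) (i : ι) :
    2 ≤ #(supportFinset (C i)) := by
  obtain ⟨u, v, huv⟩ := ne_bot_iff_exists_adj.1 (h.ne_bot i)
  exact one_lt_card.2
    ⟨u, mem_supportFinset_of_adj huv, v, mem_supportFinset_of_adj huv.symm, huv.ne⟩

theorem card_filter_mem_supportFinset_le (h : IsColorFamily G C) {i : ι} {u : V} {S : Finset V}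
    (hui : u ∈ supportFinset (C i)) (huS : u ∉ S) :
    #{y ∈ S | y ∈ supportFinset (C i)} ≤
      edgeExcess (C i) + #{y ∈ S | (C i).Adj u y ∧ ¬ (C i).IsEdgeReachable 2 u y} := by
  set X := {y ∈ S | y ∈ supportFinset (C i)}
  have hX : insert u X ⊆ supportFinset (C i) :=
    insert_subset hui fun y hy => (mem_filter.1 hy).2
  have hXcard : #(insert u X) = #X + 1 :=
    card_insert_of_notMem fun hu => huS (mem_filter.1 hu).1
  by_cases h2 : ∃ y, u ≠ y ∧ (C i).IsEdgeReachable 2 u y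
  · obtain ⟨y, hne, hy⟩ := h2
    have := card_le_card hX
    have := h.card_supportFinset_le_of_isEdgeReachable_two hne hy
    omega
  push Not at h2
  have hsupp := h.card_supportFinset_le i
  obtain ⟨v, huv⟩ := mem_supportFinset.1 hui
  by_cases hvS : v ∈ S
  · have hpos : 0 < #{y ∈ S | (C i).Adj u y ∧ ¬ (C i).IsEdgeReachable 2 u y} :=
      card_pos.2 ⟨v, mem_filter.2 ⟨hvS, huv, h2 v huv.ne⟩⟩
    have := card_le_card hX
    omega
  · have hv : v ∉ insert u X := fun hv =>
      (mem_insert.1 hv).elim huv.ne' fun hv => hvS (mem_filter.1 hv).1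
    have := card_le_card (insert_subset (mem_supportFinset_of_adj huv.symm) hX)
    rw [card_insert_of_notMem hv] at this
    omega

variable [Fintype ι]

theorem joining_nonempty (h : IsColorFamily G C) {u v : V} (hne : u ≠ v) :
    (joining C u v).Nonempty := by
  rcases h.cover hne with ⟨i, hi⟩ | ⟨i, _, -, hi, -⟩
  · exact ⟨i, mem_joining_of_reachable hne (hi.reachable two_ne_zero)⟩
  · exact ⟨i, mem_joining_of_reachable hne hi⟩

theorem isEdgeReachable_two_of_joining_eq (h : IsColorFamily G C) {i : ι} {u v : V}
    (hne : u ≠ v) (hi : joining C u v = {i}) : (C i).IsEdgeReachable 2 u v := by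
  have heq {j : ι} (hj : (C j).Reachable u v) : j = i :=
    mem_singleton.1 (hi ▸ mem_joining_of_reachable hne hj)
  rcases h.cover hne with ⟨j, hj⟩ | ⟨j, k, hjk, hj, hk⟩
  · exact heq (hj.reachable two_ne_zero) ▸ hj
  · exact absurd ((heq hj).trans (heq hk).symm) hjk

theorem one_add_card_bridge_le_card_joining (h : IsColorFamily G C) {u y : V} (hne : u ≠ y) :
    1 + #{i | (C i).Adj u y ∧ ¬ (C i).IsEdgeReachable 2 u y} ≤ #(joining C u y) := by
  rcases Finset.eq_empty_or_nonempty
    {i | (C i).Adj u y ∧ ¬ (C i).IsEdgeReachable 2 u y} with hempty | ⟨i, hi⟩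
  · rw [hempty, card_empty]
    exact card_pos.2 (h.joining_nonempty hne)
  rw [mem_filter_univ] at hi
  have hbridge : #{i | (C i).Adj u y ∧ ¬ (C i).IsEdgeReachable 2 u y} ≤ 1 :=
    card_le_one.2 fun j hj k hk =>
      h.eq_of_adj (mem_filter.1 hj).2.1 (mem_filter.1 hk).2.1
  have hmem : i ∈ joining C u y := mem_joining_of_reachable hne hi.1.reachable
  have hcard : #(joining C u y) ≠ 1 := fun hone => by
    obtain ⟨j, hj⟩ := card_eq_one.1 hone
    obtain rfl : i = j := mem_singleton.1 (hj ▸ hmem)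
    exact hi.2 (h.isEdgeReachable_two_of_joining_eq hne hj)
  have := card_pos.2 ⟨i, hmem⟩
  omega

/-- A member `C i` contains more than `e(C i) - 1` vertices of `S` only if it joins `u` to a vertex
of `S` by a bridge, and then that vertex lies in a second member together with `u`. -/
theorem card_le_sum_edgeExcess (h : IsColorFamily G C) {u : V} {S : Finset V} (hu : u ∉ S) :
    #S ≤ ∑ i with ∃ y ∈ S, i ∈ joining C u y, edgeExcess (C i) := by
  set F : Finset ι := {i | ∃ y ∈ S, i ∈ joining C u y}
  have hFsub {y : V} (hy : y ∈ S) : joining C u y ⊆ {i ∈ F | y ∈ supportFinset (C i)} :=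
    fun i hi => mem_filter.2 ⟨mem_filter.2 ⟨mem_univ _, y, hy, hi⟩, (mem_joining.1 hi).2⟩
  have hlower : #S + ∑ y ∈ S, #{i ∈ F | (C i).Adj u y ∧ ¬ (C i).IsEdgeReachable 2 u y} ≤
      ∑ y ∈ S, #{i ∈ F | y ∈ supportFinset (C i)} := by
    rw [card_eq_sum_ones, ← sum_add_distrib]
    refine sum_le_sum fun y hy => ?_
    have hne : u ≠ y := fun huy => hu (huy ▸ hy)
    exact (Nat.add_le_add_left (card_le_card (filter_subset_filter _ (subset_univ F))) 1).trans
      ((h.one_add_card_bridge_le_card_joining hne).trans (card_le_card (hFsub hy)))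
  have hupper : ∑ i ∈ F, #{y ∈ S | y ∈ supportFinset (C i)} ≤ ∑ i ∈ F, edgeExcess (C i) +
      ∑ i ∈ F, #{y ∈ S | (C i).Adj u y ∧ ¬ (C i).IsEdgeReachable 2 u y} := by
    rw [← sum_add_distrib]
    refine sum_le_sum fun i hi => ?_
    obtain ⟨y, -, hy⟩ := (mem_filter.1 hi).2
    exact h.card_filter_mem_supportFinset_le (mem_joining.1 hy).1 hu
  have hcount (r : V → ι → Prop) [∀ y i, Decidable (r y i)] :
      ∑ y ∈ S, #{i ∈ F | r y i} = ∑ i ∈ F, #{y ∈ S | r y i} :=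
    sum_card_bipartiteAbove_eq_sum_card_bipartiteBelow r
  rw [hcount, hcount] at hlower
  omega

theorem card_joining_add_card_lt {w : V} {U M : Finset V} {i : ι} (hw : w ∉ U)
    (hwi : w ∈ supportFinset (C i)) (hM : M ⊆ (supportFinset (C i)).erase w)
    (hadj : ∀ u ∈ M, u ∈ U → (C i).Adj w u) :
    #{u ∈ U | i ∈ joining C w u} + #M < #(supportFinset (C i)) + #{u ∈ U | (C i).Adj w u} := by
  set X := {u ∈ U | i ∈ joining C w u}
  have hunion : X ∪ M ⊆ (supportFinset (C i)).erase w := by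
    refine union_subset (fun u hu => ?_) hM
    obtain ⟨huU, hu⟩ := mem_filter.1 hu
    exact mem_erase.2 ⟨fun huw => hw (huw ▸ huU), (mem_joining.1 hu).2⟩
  have hinter : X ∩ M ⊆ {u ∈ U | (C i).Adj w u} := fun u hu => by
    have huU := (mem_filter.1 (mem_inter.1 hu).1).1
    exact mem_filter.2 ⟨huU, hadj u (mem_inter.1 hu).2 huU⟩
  have := card_union_add_card_inter X M
  have := card_le_card hunion
  have := card_le_card hinter
  have := card_erase_add_one hwi
  omega

/-- How far `edgeExcess (C i)` exceeds what `C i` has to pay for: one unit for each `u ∈ U` that it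
joins to `w` other than by an edge `wu`. -/
noncomputable def surplus (C : ι → SimpleGraph V) (w : V) (U : Finset V) (i : ι) : ℕ :=
  edgeExcess (C i) + #{u ∈ U | (C i).Adj w u} - #{u ∈ U | i ∈ joining C w u}

theorem card_joining_add_surplus (h : IsColorFamily G C) {w : V} {U : Finset V} (hw : w ∉ U)
    (i : ι) : #{u ∈ U | i ∈ joining C w u} + surplus C w U i =
      edgeExcess (C i) + #{u ∈ U | (C i).Adj w u} := by
  refine Nat.add_sub_cancel' ?_
  by_cases hwi : w ∈ supportFinset (C i)
  · obtain ⟨v, hwv⟩ := mem_supportFinset.1 hwi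
    have hlt := card_joining_add_card_lt (C := C) (M := {v}) hw hwi
      (singleton_subset_iff.2 <| mem_erase.2 ⟨hwv.ne', mem_supportFinset_of_adj hwv.symm⟩)
      (fun u hu _ => (mem_singleton.1 hu).symm ▸ hwv)
    have := h.card_supportFinset_le i
    rw [card_singleton] at hlt
    omega
  · rw [filter_false_of_mem fun u _ hu => hwi (mem_joining.1 hu).1]
    exact Nat.zero_le _

theorem surplus_eq_edgeExcess {w : V} {U : Finset V} {i : ι}
    (hwi : w ∉ supportFinset (C i)) : surplus C w U i = edgeExcess (C i) := by
  rw [surplus, filter_false_of_mem fun u _ hu => hwi (mem_supportFinset_of_adj hu),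
    filter_false_of_mem fun u _ hu => hwi (mem_joining.1 hu).1]
  rfl

theorem two_le_surplus (h : IsColorFamily G C) {w v : V} {U : Finset V} {i : ι} (hw : w ∉ U)
    (hne : w ≠ v) (h2 : (C i).IsEdgeReachable 2 w v) : 2 ≤ surplus C w U i := by
  have hlt := card_joining_add_card_lt (C := C) (M := (C i).neighborFinset w) hw
    (mem_supportFinset_of_reachable hne (h2.reachable two_ne_zero))
    (fun u hu => by
      rw [mem_neighborFinset] at hu
      exact mem_erase.2 ⟨hu.ne', mem_supportFinset_of_adj hu.symm⟩)
    (fun u hu _ => (mem_neighborFinset ..).1 hu)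
  have hdeg := h2.le_degree hne
  have := h.card_supportFinset_le_of_isEdgeReachable_two hne h2
  have := h.card_joining_add_surplus hw i
  rw [card_neighborFinset_eq_degree] at hlt
  omega

theorem surplus_pos (h : IsColorFamily G C) {w v : V} {U : Finset V} {i : ι} (hw : w ∉ U)
    (hv : v ∉ U) (hne : v ≠ w) (hwi : w ∈ supportFinset (C i)) (hvi : v ∈ supportFinset (C i))
    (hnadj : ¬ (C i).Adj w v) : 0 < surplus C w U i := by
  obtain ⟨x, hwx⟩ := mem_supportFinset.1 hwi
  have hvx : v ≠ x := fun hvx => hnadj (hvx ▸ hwx)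
  have hlt := card_joining_add_card_lt (C := C) (M := {v, x}) hw hwi
    (by
      refine insert_subset (mem_erase.2 ⟨hne, hvi⟩) (singleton_subset_iff.2 ?_)
      exact mem_erase.2 ⟨hwx.ne', mem_supportFinset_of_adj hwx.symm⟩)
    (by
      rintro u hu huU
      rcases mem_insert.1 hu with rfl | hu
      · exact absurd huU hv
      · rwa [mem_singleton.1 hu])
  have := h.card_supportFinset_le i
  have := h.card_joining_add_surplus hw i
  rw [card_pair hvx] at hlt
  omega

omit [Fintype V] in
theorem sum_card_adj_le (h : IsColorFamily G C) (w : V) (U : Finset V) :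
    ∑ i, #{u ∈ U | (C i).Adj w u} ≤ #{u ∈ U | G.Adj w u} := by
  rw [← card_biUnion]
  · refine card_le_card (biUnion_subset.2 fun i _ u hu => ?_)
    exact mem_filter.2 ⟨(mem_filter.1 hu).1, h.le i (mem_filter.1 hu).2⟩
  · exact fun i _ j _ hij => disjoint_left.2 fun u hi hj =>
      hij (h.eq_of_adj (mem_filter.1 hi).2 (mem_filter.1 hj).2)

theorem two_mul_card_le_sum_card_joining_add (h : IsColorFamily G C) {w : V} {U : Finset V}
    (hw : w ∉ U) :
    2 * #U ≤ ∑ i, #{u ∈ U | i ∈ joining C w u} + #{u ∈ U | #(joining C w u) = 1} := by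
  have hcount (r : V → ι → Prop) [∀ y i, Decidable (r y i)] :
      ∑ y ∈ U, #{i | r y i} = ∑ i, #{y ∈ U | r y i} :=
    sum_card_bipartiteAbove_eq_sum_card_bipartiteBelow r
  rw [← hcount, card_filter, ← sum_add_distrib, mul_comm, ← smul_eq_mul]
  refine card_nsmul_le_sum _ _ _ fun u hu => ?_
  have hpos := (h.joining_nonempty fun hwu : w = u => hw (hwu ▸ hu)).card_pos
  rw [filter_univ_mem]
  split_ifs <;> omega

theorem card_not_adj_add_sum_surplus_le (h : IsColorFamily G C) {w : V} {U : Finset V}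
    (hw : w ∉ U) (i₀ : ι) :
    #{u ∈ U | ¬ G.Adj w u} + #U + #{u ∈ U | (C i₀).Adj w u} +
        ∑ i ∈ univ.erase i₀, surplus C w U i ≤
      ∑ i ∈ univ.erase i₀, edgeExcess (C i) + #{u ∈ U | i₀ ∈ joining C w u} +
        #{u ∈ U | #(joining C w u) = 1} := by
  have hpay : ∑ i ∈ univ.erase i₀, #{u ∈ U | i ∈ joining C w u} +
      ∑ i ∈ univ.erase i₀, surplus C w U i = ∑ i ∈ univ.erase i₀, edgeExcess (C i) +
      ∑ i ∈ univ.erase i₀, #{u ∈ U | (C i).Adj w u} := by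
    simp only [← sum_add_distrib, h.card_joining_add_surplus hw]
  have hadj := h.sum_card_adj_le w U
  have hjoin := h.two_mul_card_le_sum_card_joining_add hw
  have hsplit := card_filter_add_card_filter_not (s := U) fun u => G.Adj w u
  rw [← sum_erase_add _ _ (mem_univ i₀)] at hadj hjoin
  omega

/-- All members that connect `v` to `S` avoid `w`, and the only one connecting `v` to `w` has
surplus at least two. -/
theorem card_add_two_le_sum_surplus (h : IsColorFamily G C) {w v : V} {U S : Finset V} {i₀ j : ι}
    (hw : w ∉ U) (hne : w ≠ v) (hj : joining C w v = {j}) (hv : v ∉ supportFinset (C i₀))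
    (hS : Disjoint S (supportFinset (C j))) :
    #S + 2 ≤ ∑ i ∈ univ.erase i₀, surplus C w U i := by
  obtain ⟨hwj, hvj⟩ := mem_joining.1 (hj ▸ mem_singleton_self j)
  have hji₀ : j ≠ i₀ := fun hji₀ => hv (hji₀ ▸ hvj)
  set F : Finset ι := {i | ∃ y ∈ S, i ∈ joining C v y}
  have hF {i : ι} (hi : i ∈ F) : v ∈ supportFinset (C i) ∧ w ∉ supportFinset (C i) := by
    obtain ⟨y, hyS, hy⟩ := (mem_filter.1 hi).2
    obtain ⟨hvi, hyi⟩ := mem_joining.1 hy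
    refine ⟨hvi, fun hwi => disjoint_left.1 hS hyS ?_⟩
    have hij : i = j := mem_singleton.1 (hj ▸ mem_joining.2 ⟨hwi, hvi⟩)
    exact hij ▸ hyi
  have hjF : j ∉ F := fun hjF => (hF hjF).2 hwj
  calc #S + 2 ≤ ∑ i ∈ F, edgeExcess (C i) + surplus C w U j :=
        Nat.add_le_add (h.card_le_sum_edgeExcess fun hvS => disjoint_left.1 hS hvS hvj)
          (h.two_le_surplus hw hne (h.isEdgeReachable_two_of_joining_eq hne hj))
    _ = ∑ i ∈ insert j F, surplus C w U i := by
        rw [sum_insert hjF, add_comm,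
          sum_congr rfl fun i hi => surplus_eq_edgeExcess (U := U) (hF hi).2]
    _ ≤ ∑ i ∈ univ.erase i₀, surplus C w U i := by
        refine sum_le_sum_of_subset (insert_subset (mem_erase.2 ⟨hji₀, mem_univ j⟩) fun i hi => ?_)
        exact mem_erase.2 ⟨fun hii₀ => hv (hii₀ ▸ (hF hi).1), mem_univ i⟩

theorem sum_surplus_pos (h : IsColorFamily G C) {w v u : V} {U : Finset V} {i₀ : ι} (hw : w ∉ U)
    (hv : v ∉ U) (hu : u ∉ supportFinset (C i₀)) (hwv : (C i₀).Adj w v) :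
    0 < ∑ i ∈ univ.erase i₀, surplus C w U i := by
  have hvu : v ≠ u := fun hvu => hu (hvu ▸ mem_supportFinset_of_adj hwv.symm)
  have hmem {i : ι} (hi : i ∈ joining C v u) : i ∈ univ.erase i₀ :=
    mem_erase.2 ⟨fun hii₀ => hu (hii₀ ▸ (mem_joining.1 hi).2), mem_univ i⟩
  by_cases hjoin : ∃ i ∈ joining C v u, w ∈ supportFinset (C i)
  · obtain ⟨i, hi, hwi⟩ := hjoin
    have hpos : 0 < surplus C w U i :=
      h.surplus_pos hw hv hwv.ne' hwi (mem_joining.1 hi).1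
        fun hadj => (mem_erase.1 (hmem hi)).1 (h.eq_of_adj hadj hwv)
    exact hpos.trans_le (single_le_sum (fun _ _ => Nat.zero_le _) (hmem hi))
  · push Not at hjoin
    have hlocal := h.card_le_sum_edgeExcess (S := {u}) (mem_singleton.not.2 hvu)
    simp only [card_singleton, mem_singleton, exists_eq_left, filter_univ_mem] at hlocal
    rw [sum_congr rfl fun i hi => (surplus_eq_edgeExcess (U := U) (hjoin i hi)).symm] at hlocal
    exact Nat.lt_of_lt_of_le hlocal (sum_le_sum_of_subset fun i => hmem)

theorem card_joining_eq_one_lt_sum_surplus (h : IsColorFamily G C) {w : V} {U : Finset V} {i₀ : ι}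
    (hmax : ∀ i, #(supportFinset (C i)) ≤ #(supportFinset (C i₀)))
    (hU : ∀ y, y ∈ U ↔ ¬ (C i₀).IsEdgeReachable 2 w y) (hwi₀ : w ∈ supportFinset (C i₀))
    (hR : ∃ v ∈ U, #(joining C w v) = 1) :
    #{u ∈ U | #(joining C w u) = 1} < ∑ i ∈ univ.erase i₀, surplus C w U i := by
  have hw : w ∉ U := fun hw => (hU w).1 hw (.refl w)
  have hne {u : V} (hu : u ∈ U) : w ≠ u := fun hwu => hw (hwu ▸ hu)
  set R := {u ∈ U | #(joining C w u) = 1}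
  have hRi₀ {u : V} (hu : u ∈ R) : u ∉ supportFinset (C i₀) := fun hui₀ => by
    obtain ⟨huU, hu1⟩ := mem_filter.1 hu
    obtain ⟨j, hj⟩ := card_eq_one.1 hu1
    obtain rfl : i₀ = j := mem_singleton.1 (hj ▸ mem_joining.2 ⟨hwi₀, hui₀⟩)
    exact (hU u).1 huU (h.isEdgeReachable_two_of_joining_eq (hne huU) hj)
  obtain ⟨v, hvU, hv1⟩ := hR
  obtain ⟨j, hj⟩ := card_eq_one.1 hv1
  have hgain := h.card_add_two_le_sum_surplus (i₀ := i₀) hw (hne hvU) hj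
    (hRi₀ (mem_filter.2 ⟨hvU, hv1⟩))
    (S := (R ∪ supportFinset (C i₀)) \ supportFinset (C j)) disjoint_sdiff_self_left
  have hunion := card_union_of_disjoint (disjoint_left.2 fun u => hRi₀ (u := u))
  have := le_card_sdiff (supportFinset (C j)) (R ∪ supportFinset (C i₀))
  have := hmax j
  omega

theorem card_joining_eq_one_add_two_le (h : IsColorFamily G C) {w : V} {U : Finset V} {i₀ : ι}
    (hmax : ∀ i, #(supportFinset (C i)) ≤ #(supportFinset (C i₀))) (hw : w ∉ U)
    (hwi₀ : w ∉ supportFinset (C i₀)) :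
    #{u ∈ U | #(joining C w u) = 1} + 2 ≤
      ∑ i ∈ univ.erase i₀, surplus C w U i + #(supportFinset (C i₀)) := by
  set R := {u ∈ U | #(joining C w u) = 1}
  have hsingle {v : V} (hv : v ∈ R) : w ≠ v ∧ ∃ j, joining C w v = {j} :=
    ⟨fun hwv => hw (hwv ▸ (mem_filter.1 hv).1), card_eq_one.1 (mem_filter.1 hv).2⟩
  by_cases hRi₀ : R ⊆ supportFinset (C i₀)
  · rcases R.eq_empty_or_nonempty with hR | ⟨v, hv⟩
    · rw [hR, card_empty]
      have := h.two_le_card_supportFinset i₀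
      omega
    · obtain ⟨hne, j, hj⟩ := hsingle hv
      have hji₀ : j ≠ i₀ := fun hji₀ =>
        hwi₀ (hji₀ ▸ (mem_joining.1 (hj ▸ mem_singleton_self j)).1)
      have := h.two_le_surplus hw hne (h.isEdgeReachable_two_of_joining_eq hne hj)
      have := single_le_sum (f := surplus C w U) (fun _ _ => Nat.zero_le _)
        (mem_erase.2 ⟨hji₀, mem_univ j⟩)
      have := card_le_card hRi₀
      omega
  · obtain ⟨v, hv, hvi₀⟩ := not_subset.1 hRi₀
    obtain ⟨hne, j, hj⟩ := hsingle hv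
    have hgain := h.card_add_two_le_sum_surplus hw hne hj hvi₀
      (S := R \ supportFinset (C j)) disjoint_sdiff_self_left
    have hwj := (mem_joining.1 (hj ▸ mem_singleton_self j)).1
    have hinter : R ∩ supportFinset (C j) ⊆ (supportFinset (C j)).erase w := fun u hu =>
      mem_erase.2 ⟨(hsingle (mem_inter.1 hu).1).1.symm, (mem_inter.1 hu).2⟩
    have := card_le_card hinter
    have := card_erase_add_one hwj
    have := card_sdiff_add_card_inter R (supportFinset (C j))
    have := hmax j
    omega

theorem card_joining_eq_one_lt_sum_surplus_add_card_adj (h : IsColorFamily G C) {w : V}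
    {U : Finset V} {i₀ : ι}
    (hmax : ∀ i, #(supportFinset (C i)) ≤ #(supportFinset (C i₀)))
    (hU : ∀ y, y ∈ U ↔ ¬ (C i₀).IsEdgeReachable 2 w y) (hwi₀ : w ∈ supportFinset (C i₀))
    (hwU : (∃ y ∈ U, (C i₀).Adj w y) ∨ Disjoint U (supportFinset (C i₀))) (hne : U.Nonempty) :
    #{u ∈ U | #(joining C w u) = 1} <
      ∑ i ∈ univ.erase i₀, surplus C w U i + #{u ∈ U | (C i₀).Adj w u} := by
  by_cases hR : ∃ v ∈ U, #(joining C w v) = 1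
  · exact Nat.lt_add_right _ (h.card_joining_eq_one_lt_sum_surplus hmax hU hwi₀ hR)
  rw [filter_false_of_mem fun v hv hv1 => hR ⟨v, hv, hv1⟩, card_empty]
  rcases hwU with ⟨y, hyU, hwy⟩ | hdisj
  · exact Nat.add_pos_right _ (card_pos.2 ⟨y, mem_filter.2 ⟨hyU, hwy⟩⟩)
  · obtain ⟨v, hwv⟩ := mem_supportFinset.1 hwi₀
    obtain ⟨u, hu⟩ := hne
    exact Nat.add_pos_left (h.sum_surplus_pos (fun hw => (hU w).1 hw (.refl w))
      (fun hv => disjoint_left.1 hdisj hv (mem_supportFinset_of_adj hwv.symm))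
      (disjoint_left.1 hdisj hu) hwv) _

theorem card_not_adj_add_card_lt (h : IsColorFamily G C) {w : V} {i₀ : ι}
    (hmax : ∀ i, #(supportFinset (C i)) ≤ #(supportFinset (C i₀)))
    (hw : w ∈ (C i₀).support → (∃ y, (C i₀).Adj w y ∧ ¬ (C i₀).IsEdgeReachable 2 w y) ∨
      ∀ y ∈ (C i₀).support, (C i₀).IsEdgeReachable 2 w y)
    (hne : ∃ y, ¬ (C i₀).IsEdgeReachable 2 w y) :
    {y | ¬ (C i₀).IsEdgeReachable 2 w y ∧ ¬ G.Adj w y}.ncard + Fintype.card V <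
      ∑ i ∈ univ.erase i₀, edgeExcess (C i) + #(supportFinset (C i₀)) := by
  set U : Finset V := {y | ¬ (C i₀).IsEdgeReachable 2 w y} with hU_def
  have hU (y : V) : y ∈ U ↔ ¬ (C i₀).IsEdgeReachable 2 w y := mem_filter_univ y
  have hwU : w ∉ U := fun hw => (hU w).1 hw (.refl w)
  have hcount := h.card_not_adj_add_sum_surplus_le hwU i₀
  have hncard : {y | ¬ (C i₀).IsEdgeReachable 2 w y ∧ ¬ G.Adj w y}.ncard =
      #{u ∈ U | ¬ G.Adj w u} := by
    rw [← Set.ncard_coe_finset, hU_def, filter_filter, coe_filter_univ]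
  rw [hncard]
  by_cases hwi₀ : w ∈ supportFinset (C i₀)
  · have hsurplus := h.card_joining_eq_one_lt_sum_surplus_add_card_adj hmax hU hwi₀
      ((hw (mem_supportFinset.1 hwi₀)).imp (fun ⟨y, hwy, hy⟩ => ⟨y, (hU y).2 hy, hwy⟩)
        fun h2 => disjoint_left.2 fun y hy hyi₀ => (hU y).1 hy (h2 y (mem_supportFinset.1 hyi₀)))
      (hne.imp fun y => (hU y).2)
    have hcompl : (supportFinset (C i₀))ᶜ ⊆ {u ∈ U | i₀ ∉ joining C w u} := fun y hy => by
      have hyi₀ := mem_compl.1 hy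
      refine mem_filter.2 ⟨(hU y).2 fun h2 => ?_, fun hj => hyi₀ (mem_joining.1 hj).2⟩
      exact hyi₀ (mem_supportFinset_of_reachable (fun hyw => hyi₀ (hyw ▸ hwi₀))
        (h2.reachable two_ne_zero).symm)
    have := card_le_card hcompl
    have := card_add_card_compl (supportFinset (C i₀))
    have := card_filter_add_card_filter_not (s := U) fun u => i₀ ∈ joining C w u
    omega
  · have hsurplus := h.card_joining_eq_one_add_two_le hmax hwU hwi₀
    have hcompl : {w}ᶜ ⊆ U := fun y hy => (hU y).2 fun h2 =>
      hwi₀ (mem_supportFinset_of_reachable (Ne.symm (notMem_singleton.1 (mem_compl.1 hy)))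
        (h2.reachable two_ne_zero))
    have := card_le_card hcompl
    have hsingle := card_add_card_compl {w}
    rw [filter_false_of_mem (p := fun u => i₀ ∈ joining C w u)
      fun u _ hj => hwi₀ (mem_joining.1 hj).1] at hcount
    rw [card_empty] at hcount
    rw [card_singleton] at hsingle
    omega

end IsColorFamily

section Bridgeless

variable {V : Type*} {K : SimpleGraph V}

/-- The subgraph of `K` that is obtained by removing all bridges. -/
def bridgeless (K : SimpleGraph V) : SimpleGraph V where
  Adj u v := K.Adj u v ∧ K.IsEdgeReachable 2 u v
  symm := ⟨fun _ _ h => ⟨h.1.symm, h.2.symm⟩⟩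
  loopless := ⟨fun _ h => h.1.ne rfl⟩

theorem bridgeless_adj {u v : V} :
    (bridgeless K).Adj u v ↔ K.Adj u v ∧ K.IsEdgeReachable 2 u v :=
  Iff.rfl

theorem bridgeless_le (K : SimpleGraph V) : bridgeless K ≤ K :=
  fun _ _ h => h.1

theorem isEdgeReachable_two_bridgeless_iff {u v : V} :
    (bridgeless K).IsEdgeReachable 2 u v ↔ K.IsEdgeReachable 2 u v := by
  refine ⟨fun h => h.mono (bridgeless_le K), fun h => isEdgeReachable_two.2 fun e => ?_⟩
  obtain ⟨p, hp⟩ := (isEdgeReachable_two.1 h e).exists_isPath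
  have hmem {x : V} (hx : x ∈ p.support) : x ∈ (p.mapLe (deleteEdges_le _)).support := by
    rwa [Walk.support_mapLe_eq_support]
  refine ⟨p.transfer _ fun f hf => ?_⟩
  induction f with
  | h a b =>
    have hab := deleteEdges_adj.1 (p.adj_of_mem_edges hf)
    refine deleteEdges_adj.2 ⟨⟨hab.1, ?_⟩, hab.2⟩
    exact (hp.isTrail.mapLe (deleteEdges_le _)).isEdgeReachable_two_of_isEdgeReachable_two h
      (hmem (p.fst_mem_support_of_mem_edges hf)) (hmem (p.snd_mem_support_of_mem_edges hf))

theorem card_twoEdgeClass_bridgeless (K : SimpleGraph V) :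
    Nat.card (TwoEdgeClass (bridgeless K)) = Nat.card (TwoEdgeClass K) :=
  congrArg (fun s : Setoid V => Nat.card (Quotient s))
    (Setoid.ext fun _ _ => isEdgeReachable_two_bridgeless_iff)

theorem ncard_edgeSet_bridgeless_add_ncard_edgeSet_classGraph_le [Finite V]
    (K : SimpleGraph V) :
    (bridgeless K).edgeSet.ncard + (classGraph K K).edgeSet.ncard ≤ K.edgeSet.ncard := by
  have hsub : (classGraph K K).edgeSet ⊆
      Sym2.map (twoEdgeClass K) '' (K.edgeSet \ (bridgeless K).edgeSet) := by
    intro q hq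
    obtain ⟨e, he, rfl⟩ := exists_mem_edgeSet_of_mem_edgeSet_classGraph hq
    refine ⟨e, ⟨he, fun heb => ?_⟩, rfl⟩
    induction e with
    | h u v => exact (classGraph K K).ne_of_adj hq (twoEdgeClass_eq_iff.2 (bridgeless_adj.1 heb).2)
  have := (Set.ncard_le_ncard hsub (Set.toFinite _)).trans (Set.ncard_image_le (Set.toFinite _))
  have := Set.ncard_sdiff_add_ncard_of_subset (edgeSet_mono (bridgeless_le K))
  omega

theorem ncard_edgeSet_bridgeless_add_card_twoEdgeClass_le [Finite V] (K : SimpleGraph V)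
    (k : V) : (bridgeless K).edgeSet.ncard + Nat.card (TwoEdgeClass K) ≤
      K.edgeSet.ncard + {v | ¬ K.Reachable k v}.ncard + 1 := by
  set T := {c | (classGraph K K).Reachable (twoEdgeClass K k) c}
  have hcompl : Tᶜ ⊆ twoEdgeClass K '' {v | ¬ K.Reachable k v} := by
    intro c hc
    obtain ⟨v, rfl⟩ := twoEdgeClass_surjective K c
    exact ⟨v, fun hv => hc (classGraph_reachable hv), rfl⟩
  have := (Set.ncard_le_ncard hcompl (Set.toFinite _)).trans
    (Set.ncard_image_le (Set.toFinite _))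
  have := Set.ncard_add_ncard_compl T
  have : T.ncard ≤ _ := ncard_reachable_le (classGraph K K) (twoEdgeClass K k)
  have := ncard_edgeSet_bridgeless_add_ncard_edgeSet_classGraph_le K
  omega

end Bridgeless

section Leaving

variable {V : Type*} {K : SimpleGraph V} {u y : V}

theorem exists_adj_not_isEdgeReachable_two (h : K.Reachable u y)
    (hy : ¬ K.IsEdgeReachable 2 u y) :
    ∃ w, K.IsEdgeReachable 2 u w ∧ ∃ z, K.Adj w z ∧ ¬ K.IsEdgeReachable 2 w z := by
  obtain ⟨p⟩ := h
  induction p with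
  | nil => exact absurd .rfl hy
  | @cons u z y huz _ ih =>
    by_cases h2 : K.IsEdgeReachable 2 u z
    · obtain ⟨w, hw, hadj⟩ := ih fun hzy => hy (h2.trans hzy)
      exact ⟨w, h2.trans hw, hadj⟩
    · exact ⟨u, .rfl, z, huz, h2⟩

theorem exists_adj_not_isEdgeReachable_two_or_forall
    (hK : ∀ x ∈ K.support, ∀ y ∈ K.support, K.Reachable x y) (u : V) :
    ∃ w, K.IsEdgeReachable 2 u w ∧ (w ∈ K.support →
      (∃ y, K.Adj w y ∧ ¬ K.IsEdgeReachable 2 w y) ∨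
        ∀ y ∈ K.support, K.IsEdgeReachable 2 w y) := by
  by_cases hall : u ∈ K.support → ∀ y ∈ K.support, K.IsEdgeReachable 2 u y
  · exact ⟨u, .rfl, fun hu => .inr (hall hu)⟩
  · push Not at hall
    obtain ⟨hu, y, hy, h2⟩ := hall
    obtain ⟨w, hw, hadj⟩ := exists_adj_not_isEdgeReachable_two (hK u hu y hy) h2
    exact ⟨w, hw, fun _ => .inl hadj⟩

end Leaving

namespace IsColorFamily

open Finset
open scoped Classical

variable {V ι : Type*} [Fintype V] [Fintype ι] {G : SimpleGraph V} {C : ι → SimpleGraph V}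

theorem exists_isEdgeConnected_two_of_card_supportFinset_le (h : IsColorFamily G C)
    (hG : G.IsEdgeConnected 2) {i₀ : ι}
    (hmax : ∀ i, #(supportFinset (C i)) ≤ #(supportFinset (C i₀)))
    (hi₀ : ¬ (C i₀).IsEdgeConnected 2) :
    ∃ H ≤ G, H.IsEdgeConnected 2 ∧
      H.edgeSet.ncard ≤ (C i₀).edgeSet.ncard + ∑ i ∈ univ.erase i₀, edgeExcess (C i) := by
  obtain ⟨k, _, hk⟩ := ne_bot_iff_exists_adj.1 (h.ne_bot i₀)
  have : Nonempty V := ⟨k⟩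
  obtain ⟨w₀, hw₀⟩ :=
    exists_isEdgeConnected_two_extension hG ((bridgeless_le _).trans (h.le i₀))
  simp only [isEdgeReachable_two_bridgeless_iff, card_twoEdgeClass_bridgeless] at hw₀
  obtain ⟨w, hw₀w, hw⟩ := exists_adj_not_isEdgeReachable_two_or_forall
    (fun _ hx _ hy => h.reachable (i := i₀) hx hy) w₀
  obtain ⟨H, -, hHG, hH, hcard⟩ := hw₀ w hw₀w
  refine ⟨H, hHG, hH, ?_⟩
  have hne : ∃ y, ¬ (C i₀).IsEdgeReachable 2 w y := by
    by_contra! hall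
    exact hi₀ fun x y => (hall x).symm.trans (hall y)
  have hcore := h.card_not_adj_add_card_lt hmax hw hne
  have hbridge := ncard_edgeSet_bridgeless_add_card_twoEdgeClass_le (C i₀) k
  have hcompl := Set.ncard_add_ncard_compl {v | (C i₀).Reachable k v}
  rw [← h.coe_supportFinset (mem_supportFinset_of_adj hk), Set.ncard_coe_finset,
    Nat.card_eq_fintype_card, h.coe_supportFinset (mem_supportFinset_of_adj hk),
    Set.compl_ofPred] at hcompl
  omega

omit [Fintype V] in
theorem exists_isEdgeConnected_two_le_sum_edgeExcess [Finite V] [Nontrivial V]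
    (h : IsColorFamily G C) (hG : G.IsEdgeConnected 2) :
    ∃ H ≤ G, H.IsEdgeConnected 2 ∧ H.edgeSet.ncard ≤ ∑ i, edgeExcess (C i) + 1 := by
  have := Fintype.ofFinite V
  obtain ⟨u, v, huv⟩ := exists_pair_ne V
  obtain ⟨i, -⟩ := h.joining_nonempty huv
  obtain ⟨i₀, -, hmax⟩ := exists_max_image univ (fun i => #(supportFinset (C i))) ⟨i, mem_univ i⟩
  have hsum := sum_erase_add univ (fun i => edgeExcess (C i)) (mem_univ i₀)
  have hi₀ := edgeExcess_add_one (h.ne_bot i₀)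
  by_cases h2 : (C i₀).IsEdgeConnected 2
  · exact ⟨C i₀, h.le i₀, h2, by omega⟩
  · obtain ⟨H, hHG, hH, hcard⟩ :=
      h.exists_isEdgeConnected_two_of_card_supportFinset_le hG (fun i => hmax i (mem_univ i)) h2
    exact ⟨H, hHG, hH, by omega⟩

end IsColorFamily

section DisjointPaths

variable {V : Type*} {G : SimpleGraph V} {u v w z : V}

theorem isEdgeReachable_two_of_disjoint {p q : G.Walk u v} (hpq : p.edges.Disjoint q.edges) :
    G.IsEdgeReachable 2 u v := by
  refine isEdgeReachable_two.2 fun e => ?_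
  induction e with | h a b
  rw [reachable_deleteEdges_iff_exists_walk]
  by_cases he : s(a, b) ∈ p.edges
  · exact ⟨q, hpq he⟩
  · exact ⟨p, he⟩

theorem exists_disjoint_walks_of_mem_support {p q : G.Walk u w} (hp : p.IsPath)
    (hpq : p.edges.Disjoint q.edges) (hwv : G.Adj w v) (hz : z ∈ p.support) {r : G.Walk z v}
    (hrq : r.edges.Disjoint q.edges) (hr : s(w, v) ∉ r.edges) (hvz : v ∈ p.support → v = z) :
    ∃ p' q' : G.Walk u v, p'.edges.Disjoint q'.edges := by
  classical
  refine ⟨(p.takeUntil z hz).append r, q.concat hwv, fun e he he' => ?_⟩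
  rw [Walk.edges_append, List.mem_append] at he
  rw [Walk.edges_concat, List.concat_eq_append, List.mem_append, List.mem_singleton] at he'
  rcases he with he | he <;> rcases he' with he' | rfl
  · exact hpq (p.edges_takeUntil_subset_edges hz he) he'
  · obtain rfl := hvz (p.snd_mem_support_of_mem_edges (p.edges_takeUntil_subset_edges hz he))
    exact Walk.endpoint_notMem_support_takeUntil hp hz hwv.ne
      (Walk.fst_mem_support_of_mem_edges _ he)
  · exact hrq he he'
  · exact hr he

theorem exists_disjoint_walks_of_adj (hG : G.IsEdgeConnected 2) (hwv : G.Adj w v)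
    {p q : G.Walk u w} (hp : p.IsPath) (hq : q.IsPath) (hpq : p.edges.Disjoint q.edges) :
    ∃ p' q' : G.Walk u v, p'.edges.Disjoint q'.edges := by
  classical
  obtain ⟨r, hr⟩ := reachable_deleteEdges_iff_exists_walk.1 (isEdgeReachable_two.1 (hG v u) s(w, v))
  -- Leave the new walk `r` from `v` where it first meets `p` or `q`.
  obtain ⟨z, hz, hzr, hfirst⟩ := r.exists_mem_support_forall_mem_support_imp_eq
    (p.support.toFinset ∪ q.support.toFinset) ⟨u, by simp⟩
  have hout {s : G.Walk u w} (hs : s.support.toFinset ⊆ p.support.toFinset ∪ q.support.toFinset) :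
      (r.takeUntil z hzr).reverse.edges.Disjoint s.edges := fun e he he' => by
    have hmem {x : V} (hx : x ∈ s.support) : x ∈ p.support.toFinset ∪ q.support.toFinset :=
      hs (List.mem_toFinset.2 hx)
    rw [Walk.edges_reverse, List.mem_reverse] at he
    induction e with
    | h a b =>
      refine (Walk.adj_of_mem_edges _ he).ne ?_
      exact (hfirst a (hmem (s.fst_mem_support_of_mem_edges he'))
        (Walk.fst_mem_support_of_mem_edges _ he)).trans
        (hfirst b (hmem (s.snd_mem_support_of_mem_edges he'))
          (Walk.snd_mem_support_of_mem_edges _ he)).symm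
  have hwr : s(w, v) ∉ (r.takeUntil z hzr).reverse.edges := fun he =>
    hr (r.edges_takeUntil_subset_edges hzr (by rwa [Walk.edges_reverse, List.mem_reverse] at he))
  have hvz (hv : v ∈ p.support.toFinset ∪ q.support.toFinset) : v = z :=
    hfirst v hv (Walk.start_mem_support _)
  simp only [Finset.mem_union, List.mem_toFinset] at hz hvz
  rcases hz with hz | hz
  · exact exists_disjoint_walks_of_mem_support hp hpq hwv hz (hout Finset.subset_union_right) hwr
      fun hv => hvz (.inl hv)
  · exact exists_disjoint_walks_of_mem_support hq hpq.symm hwv hz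
      (hout Finset.subset_union_left) hwr fun hv => hvz (.inr hv)

theorem exists_disjoint_paths (hG : G.IsEdgeConnected 2) (u v : V) :
    ∃ p q : G.Path u v, (p : G.Walk u v).edges.Disjoint (q : G.Walk u v).edges := by
  classical
  obtain ⟨r⟩ := (hG v u).reachable two_ne_zero
  induction r with
  | nil => exact ⟨.nil, .nil, List.disjoint_nil_left _⟩
  | cons h _ ih =>
    obtain ⟨p, q, hpq⟩ := ih
    obtain ⟨p', q', hpq'⟩ := exists_disjoint_walks_of_adj hG h.symm p.2 q.2 hpq
    exact ⟨p'.toPath, q'.toPath, fun e he he' =>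
      hpq' (p'.edges_toPath_subset_edges he) (q'.edges_toPath_subset_edges he')⟩

end DisjointPaths

section Colorings

variable {V : Type*} {G H : SimpleGraph V}

theorem isMCColoring_two_of_forall_eq (hHG : H ≤ G) (hH : H.IsEdgeConnected 2)
    {Γ : G.edgeSet → ℕ} {c : ℕ} (hΓ : ∀ e : G.edgeSet, (e : Sym2 V) ∈ H.edgeSet → Γ e = c) :
    IsMCColoring 2 Γ := by
  intro u v _
  obtain ⟨p, q, hpq⟩ := exists_disjoint_paths hH u v
  let lift (r : H.Path u v) : G.Path u v := ⟨(r : H.Walk u v).mapLe hHG, r.2.mapLe hHG⟩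
  have hmono (r : H.Path u v) : (lift r : G.Walk u v).IsMonochromatic Γ :=
    ⟨c, fun e he => hΓ _ <| (r : H.Walk u v).edges_subset_edgeSet <| by
      rwa [Walk.edges_mapLe_eq_edges] at he⟩
  have hdisj : List.Disjoint (lift p : G.Walk u v).edges (lift q : G.Walk u v).edges := by
    rwa [Walk.edges_mapLe_eq_edges, Walk.edges_mapLe_eq_edges]
  refine ⟨![lift p, lift q], Fin.forall_fin_two.2 ⟨hmono p, hmono q⟩, ?_⟩
  simp only [Fin.forall_fin_two]
  exact ⟨⟨fun h => absurd rfl h, fun _ => hdisj⟩, fun _ => hdisj.symm, fun h => absurd rfl h⟩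

theorem mcColorCounts_two_nonempty (hG : G.IsEdgeConnected 2) : (mcColorCounts 2 G).Nonempty :=
  ⟨_, fun _ => 0, isMCColoring_two_of_forall_eq le_rfl hG fun _ _ => rfl, rfl⟩

theorem exists_mem_mcColorCounts_two [Finite V] (hHG : H ≤ G) (hH : H.IsEdgeConnected 2)
    (hne : H ≠ ⊥) : ∃ m ∈ mcColorCounts 2 G, m + H.edgeSet.ncard = G.edgeSet.ncard + 1 := by
  classical
  obtain ⟨f, hf⟩ := Countable.exists_injective_nat G.edgeSet
  set T : Set G.edgeSet := {e | (e : Sym2 V) ∈ H.edgeSet}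
  set Γ : G.edgeSet → ℕ := fun e => if e ∈ T then 0 else f e + 1
  have hT : Γ '' T = {0} := by
    obtain ⟨e, he⟩ := edgeSet_nonempty.2 hne
    have hTne : T.Nonempty := ⟨⟨e, edgeSet_mono hHG he⟩, he⟩
    exact (Set.image_congr fun e he => if_pos he).trans (hTne.image_const 0)
  have hTc : Γ '' Tᶜ = (fun e => f e + 1) '' Tᶜ := Set.image_congr fun e he => if_neg he
  have hrange : Set.range Γ = insert 0 ((fun e => f e + 1) '' Tᶜ) := by
    rw [← Set.image_univ, ← Set.union_compl_self T, Set.image_union, hT, hTc]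
    rfl
  have hTcard : T.ncard = H.edgeSet.ncard :=
    Set.ncard_preimage_of_injective_subset_range Subtype.val_injective
      (by rw [Subtype.range_coe]; exact edgeSet_mono hHG)
  refine ⟨_, ⟨Γ, isMCColoring_two_of_forall_eq hHG hH (c := 0) fun e he => if_pos he, rfl⟩, ?_⟩
  rw [hrange, Set.ncard_insert_of_notMem (by simp) (Set.toFinite _),
    Set.ncard_image_of_injective (f := fun e => f e + 1) _ ((add_left_injective 1).comp hf),
    ← hTcard, ← Nat.card_coe_set_eq G.edgeSet, ← Set.ncard_add_ncard_compl T]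
  omega

end Colorings

section ColorPieces

variable {V : Type*} {G : SimpleGraph V} {Γ : G.edgeSet → ℕ} {u v : V}

/-- The graph of the edges of colour `c`. -/
def colorGraph (Γ : G.edgeSet → ℕ) (c : ℕ) : SimpleGraph V where
  Adj u v := ∃ h : G.Adj u v, Γ ⟨s(u, v), h⟩ = c
  symm := ⟨fun _ _ ⟨h, hc⟩ => ⟨h.symm, hc ▸ congrArg Γ (Subtype.ext Sym2.eq_swap)⟩⟩
  loopless := ⟨fun _ h => h.1.ne rfl⟩

/-- The components of the colour classes of `Γ` that are not just a single vertex, as the index type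
of the colour family of `Γ`. -/
abbrev ColorPiece (Γ : G.edgeSet → ℕ) : Type _ :=
  {i : Σ c : Set.range Γ, (colorGraph Γ c).ConnectedComponent //
    i.2.toSimpleGraph.spanningCoe ≠ ⊥}

/-- A component of a colour class, as a graph on all vertices. -/
def ColorPiece.graph (i : ColorPiece Γ) : SimpleGraph V :=
  i.1.2.toSimpleGraph.spanningCoe

theorem ColorPiece.graph_adj {i : ColorPiece Γ} : i.graph.Adj u v ↔
    (colorGraph Γ i.1.1).connectedComponentMk u = i.1.2 ∧ (colorGraph Γ i.1.1).Adj u v :=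
  i.1.2.adj_spanningCoe_toSimpleGraph

theorem exists_colorPiece (hne : u ≠ v) {p : G.Walk u v} {c : ℕ}
    (hc : ∀ e (he : e ∈ p.edges), Γ ⟨e, p.edges_subset_edgeSet he⟩ = c) :
    ∃ i : ColorPiece Γ, i.1.1 = c ∧ ∀ e ∈ p.edges, e ∈ i.graph.edgeSet := by
  classical
  have hcolor : ∀ e ∈ p.edges, e ∈ (colorGraph Γ c).edgeSet :=
    Sym2.ind fun a b he => ⟨p.adj_of_mem_edges he, hc _ he⟩
  have hadj : ∀ e ∈ p.edges, e ∈
      ((colorGraph Γ c).connectedComponentMk u).toSimpleGraph.spanningCoe.edgeSet := by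
    refine Sym2.ind fun a b he => ?_
    refine (ConnectedComponent.adj_spanningCoe_toSimpleGraph _).2
      ⟨ConnectedComponent.sound ?_, hcolor _ he⟩
    have ha : a ∈ (p.transfer _ hcolor).support := by
      rw [Walk.support_transfer]
      exact p.fst_mem_support_of_mem_edges he
    exact ⟨((p.transfer _ hcolor).takeUntil a ha).reverse⟩
  have hfirst := p.mk_start_snd_mem_edges (Walk.not_nil_of_ne hne)
  exact ⟨⟨⟨⟨c, _, hc _ hfirst⟩, _⟩, edgeSet_nonempty.1 ⟨_, hadj _ hfirst⟩⟩, rfl, hadj⟩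

theorem isColorFamily_colorPiece (hΓ : IsMCColoring 2 Γ) :
    IsColorFamily G (ColorPiece.graph : ColorPiece Γ → SimpleGraph V) where
  le i u v h := (ColorPiece.graph_adj.1 h).2.1
  eq_of_adj {i j u v} hi hj := by
    obtain ⟨⟨⟨c, hc⟩, C⟩, hC⟩ := i
    obtain ⟨⟨⟨d, hd⟩, D⟩, hD⟩ := j
    obtain ⟨hC, _, hc⟩ : (colorGraph Γ c).connectedComponentMk u = C ∧ (colorGraph Γ c).Adj u v :=
      ColorPiece.graph_adj.1 hi
    obtain ⟨hD, _, hd⟩ : (colorGraph Γ d).connectedComponentMk u = D ∧ (colorGraph Γ d).Adj u v :=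
      ColorPiece.graph_adj.1 hj
    subst hc hd hC hD
    rfl
  ne_bot i := i.2
  reachable {i u v} hu hv := by
    obtain ⟨u', hu⟩ := hu
    obtain ⟨v', hv⟩ := hv
    exact (i.1.2.reachable_toSimpleGraph (ColorPiece.graph_adj.1 hu).1
      (ColorPiece.graph_adj.1 hv).1).map (Embedding.spanningCoe _).toHom
  cover {u v} hne := by
    obtain ⟨P, hmono, hdisj⟩ := hΓ u v hne
    have hpiece (k : Fin 2) : ∃ i : ColorPiece Γ,
        ∀ e ∈ (P k : G.Walk u v).edges, e ∈ i.graph.edgeSet := by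
      obtain ⟨c, hc⟩ := hmono k
      obtain ⟨i, -, hi⟩ := exists_colorPiece hne hc
      exact ⟨i, hi⟩
    choose i hi using hpiece
    by_cases h01 : i 0 = i 1
    · refine .inl ⟨i 0, isEdgeReachable_two_of_disjoint
        (p := (P 0 : G.Walk u v).transfer _ (hi 0))
        (q := (P 1 : G.Walk u v).transfer _ (h01 ▸ hi 1)) ?_⟩
      rw [Walk.edges_transfer, Walk.edges_transfer]
      exact hdisj 0 1 Fin.zero_ne_one
    · exact .inr ⟨i 0, i 1, h01, ⟨(P 0 : G.Walk u v).transfer _ (hi 0)⟩,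
        ⟨(P 1 : G.Walk u v).transfer _ (hi 1)⟩⟩

theorem ncard_range_le_card_colorPiece [Finite V] (Γ : G.edgeSet → ℕ) :
    (Set.range Γ).ncard ≤ Nat.card (ColorPiece Γ) := by
  rw [← Nat.card_coe_set_eq]
  refine Nat.card_le_card_of_surjective (fun i : ColorPiece Γ => i.1.1) ?_
  rintro ⟨_, ⟨e, he⟩, rfl⟩
  induction e with
  | h u v =>
    obtain ⟨i, hi, -⟩ := exists_colorPiece (p := (mem_edgeSet G |>.1 he).toWalk)
      (Γ := Γ) (G.ne_of_adj he) (c := Γ ⟨s(u, v), he⟩) fun e he' => by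
        congr 2
        simpa using he'
    exact ⟨i, Subtype.ext hi⟩

theorem IsColorFamily.sum_edgeExcess_add_card_le [Finite V] {ι : Type*} [Fintype ι]
    {C : ι → SimpleGraph V} (h : IsColorFamily G C) :
    ∑ i, edgeExcess (C i) + Fintype.card ι ≤ G.edgeSet.ncard := by
  have hdisj : Pairwise fun i j => Disjoint (C i).edgeSet (C j).edgeSet := fun i j hij =>
    Set.disjoint_left.2 <| Sym2.ind fun u v hi hj => hij (h.eq_of_adj hi hj)
  have hsub : ⋃ i, (C i).edgeSet ⊆ G.edgeSet := Set.iUnion_subset fun i => edgeSet_mono (h.le i)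
  calc ∑ i, edgeExcess (C i) + Fintype.card ι = ∑ i, (C i).edgeSet.ncard := by
        rw [← Finset.card_univ, Finset.card_eq_sum_ones, ← Finset.sum_add_distrib,
          Finset.sum_congr rfl fun i _ => edgeExcess_add_one (h.ne_bot i)]
    _ = (⋃ i, (C i).edgeSet).ncard := by
        rw [Set.ncard_iUnion_of_finite (fun _ => Set.toFinite _) hdisj, finsum_eq_sum_of_fintype]
    _ ≤ G.edgeSet.ncard := Set.ncard_le_ncard hsub (Set.toFinite _)

end ColorPieces

section MinSpanningSize

variable {V : Type*} {G H : SimpleGraph V}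

/-- The minimum number of edges of a `2`-edge-connected spanning subgraph of `G`, and the junk value
`0` if `G` is not `2`-edge-connected. -/
noncomputable def minSpanningSize (G : SimpleGraph V) : ℕ :=
  sInf {m | ∃ H ≤ G, H.IsEdgeConnected 2 ∧ H.edgeSet.ncard = m}

theorem minSpanningSize_le (hHG : H ≤ G) (hH : H.IsEdgeConnected 2) :
    minSpanningSize G ≤ H.edgeSet.ncard :=
  Nat.sInf_le ⟨H, hHG, hH, rfl⟩

theorem exists_ncard_edgeSet_eq_minSpanningSize (hG : G.IsEdgeConnected 2) :
    ∃ H ≤ G, H.IsEdgeConnected 2 ∧ H.edgeSet.ncard = minSpanningSize G :=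
  Nat.sInf_mem (s := {m | ∃ H ≤ G, H.IsEdgeConnected 2 ∧ H.edgeSet.ncard = m})
    ⟨_, G, le_rfl, hG, rfl⟩

theorem ncard_range_add_minSpanningSize_le [Finite V] [Nontrivial V] (hG : G.IsEdgeConnected 2)
    {Γ : G.edgeSet → ℕ} (hΓ : IsMCColoring 2 Γ) :
    (Set.range Γ).ncard + minSpanningSize G ≤ G.edgeSet.ncard + 1 := by
  have := Fintype.ofFinite V
  have := Fintype.ofFinite (ColorPiece Γ)
  have hfam := isColorFamily_colorPiece hΓ
  obtain ⟨H, hHG, hH, hcard⟩ := hfam.exists_isEdgeConnected_two_le_sum_edgeExcess hG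
  have := minSpanningSize_le hHG hH
  have := hfam.sum_edgeExcess_add_card_le
  have hcolors := ncard_range_le_card_colorPiece Γ
  rw [Nat.card_eq_fintype_card] at hcolors
  omega

theorem mc_two_add_minSpanningSize [Finite V] [Nontrivial V] (hG : G.IsEdgeConnected 2) :
    mc 2 G + minSpanningSize G = G.edgeSet.ncard + 1 := by
  have hmax := mc_isGreatest 2 G (mcColorCounts_two_nonempty hG)
  obtain ⟨Γ, hΓ, hmc⟩ := hmax.1
  have hupper := ncard_range_add_minSpanningSize_le hG hΓ
  obtain ⟨H, hHG, hH, hcard⟩ := exists_ncard_edgeSet_eq_minSpanningSize hG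
  have hne : H ≠ ⊥ := by
    rintro rfl
    exact not_preconnected_bot (hH.preconnected two_ne_zero)
  obtain ⟨m, hm, hmH⟩ := exists_mem_mcColorCounts_two hHG hH hne
  have := hmax.2 hm
  omega

end MinSpanningSize

section Map

variable {V W : Type*} {K : SimpleGraph V}

theorem reachable_map_iff (f : V ↪ W) {x y : V} :
    (K.map f).Reachable (f x) (f y) ↔ K.Reachable x y := by
  refine ⟨?_, fun h => h.map (Embedding.map f K).toHom⟩
  rintro ⟨p⟩
  generalize hx : f x = a at p
  generalize hy : f y = b at p
  induction p generalizing x with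
  | nil =>
    rw [f.injective (hx.trans hy.symm)]
  | cons h p ih =>
    obtain ⟨x', c, hxc, hx', rfl⟩ := (map_adj _ _ _ _).1 h
    rw [f.injective (hx'.trans hx.symm)] at hxc
    exact hxc.reachable.trans (ih rfl hy)

theorem map_deleteEdges (f : V ↪ W) (s : Set (Sym2 W)) :
    (K.map f).deleteEdges s = (K.deleteEdges (Sym2.map f ⁻¹' s)).map f := by
  ext a b
  simp only [deleteEdges_adj, map_adj, Set.mem_preimage]
  constructor
  · rintro ⟨⟨x, y, h, rfl, rfl⟩, hs⟩
    exact ⟨x, y, ⟨h, hs⟩, rfl, rfl⟩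
  · rintro ⟨x, y, ⟨h, hs⟩, rfl, rfl⟩
    exact ⟨⟨x, y, h, rfl, rfl⟩, hs⟩

theorem isEdgeReachable_map_iff (f : V ↪ W) {k : ℕ} {x y : V} :
    (K.map f).IsEdgeReachable k (f x) (f y) ↔ K.IsEdgeReachable k x y := by
  have hf := Sym2.map.injective f.injective
  constructor
  · intro h s hs
    have := h (s := Sym2.map f '' s) (by rwa [hf.encard_image])
    rwa [map_deleteEdges, Set.preimage_image_eq _ hf, reachable_map_iff] at this
  · intro h s hs
    rw [map_deleteEdges, reachable_map_iff]
    refine h (lt_of_le_of_lt ?_ hs)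
    rw [← hf.encard_image]
    exact Set.encard_le_encard (Set.image_preimage_subset _ _)

theorem ncard_edgeSet_map (f : V ↪ W) : (K.map f).edgeSet.ncard = K.edgeSet.ncard := by
  rw [edgeSet_map]
  exact Set.ncard_image_of_injective _ f.sym2Map.injective

end Map

section Nonseparable

variable {V : Type*} {G H : SimpleGraph V} {A B : G.Subgraph} {u v x y z : V}

theorem toSubgraph_le_deleteVerts_iff {p : G.Walk x y} :
    p.toSubgraph ≤ A.deleteVerts {z} ↔ p.toSubgraph ≤ A ∧ z ∉ p.support := by
  refine ⟨fun h => ⟨h.trans Subgraph.deleteVerts_le, fun hz => ?_⟩, fun ⟨h, hz⟩ => ?_⟩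
  · exact (h.1 (p.mem_verts_toSubgraph.2 hz)).2 rfl
  · have hne {a : V} (ha : a ∈ p.toSubgraph.verts) : a ∉ ({z} : Set V) := by
      rintro rfl
      exact hz (p.mem_verts_toSubgraph.1 ha)
    exact ⟨fun a ha => ⟨h.1 ha, hne ha⟩, fun a b hab => Subgraph.deleteVerts_adj.2
      ⟨h.1 hab.fst_mem, hne hab.fst_mem, h.1 hab.snd_mem, hne hab.snd_mem, h.2 hab⟩⟩

theorem exists_walk_of_isNonseparable (hB : B.IsNonseparable) (hx : x ∈ B.verts)
    (hy : y ∈ B.verts) (hxz : x ≠ z) (hyz : y ≠ z) :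
    ∃ p : G.Walk x y, p.toSubgraph ≤ B ∧ z ∉ p.support := by
  by_cases hz : z ∈ B.verts
  · obtain ⟨p, hp⟩ := (Subgraph.preconnected_iff_forall_exists_walk_subgraph _).1 (hB.2 z hz)
      ⟨hx, hxz⟩ ⟨hy, hyz⟩
    exact ⟨p, toSubgraph_le_deleteVerts_iff.1 hp⟩
  · obtain ⟨p, hp⟩ := (Subgraph.preconnected_iff_forall_exists_walk_subgraph _).1
      hB.1.preconnected hx hy
    exact ⟨p, hp, fun h => hz (hp.1 (p.mem_verts_toSubgraph.2 h))⟩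

theorem isNonseparable_sup (hB : B.IsNonseparable) (hA : A.Connected)
    (hAB : (B.verts ∩ A.verts).Nonempty)
    (h : ∀ z, ∀ x ∈ A.verts, x ≠ z →
      ∃ w ∈ B.verts, ∃ p : G.Walk x w, p.toSubgraph ≤ A ∧ z ∉ p.support) :
    (B ⊔ A).IsNonseparable := by
  refine ⟨Subgraph.connected_sup hB.1.preconnected hA.preconnected hAB,
    fun z _ => (Subgraph.preconnected_iff_forall_exists_walk_subgraph _).2 ?_⟩
  have to_B : ∀ x ∈ (B ⊔ A).verts, x ≠ z →
      ∃ w ∈ B.verts, ∃ p : G.Walk x w, p.toSubgraph ≤ B ⊔ A ∧ z ∉ p.support := by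
    rintro x (hx | hx) hxz
    · refine ⟨x, hx, .nil, ?_, by simpa using hxz.symm⟩
      exact (G.singletonSubgraph_le_iff x B).2 hx |>.trans le_sup_left
    · obtain ⟨w, hw, p, hp, hz⟩ := h z x hx hxz
      exact ⟨w, hw, p, hp.trans le_sup_right, hz⟩
  rintro x y ⟨hx, hxz⟩ ⟨hy, hyz⟩
  obtain ⟨w, hw, p, hp, hpz⟩ := to_B x hx hxz
  obtain ⟨w', hw', q, hq, hqz⟩ := to_B y hy hyz
  obtain ⟨r, hr, hrz⟩ := exists_walk_of_isNonseparable hB hw hw'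
    (ne_of_mem_of_not_mem p.end_mem_support hpz) (ne_of_mem_of_not_mem q.end_mem_support hqz)
  refine ⟨(p.append r).append q.reverse, toSubgraph_le_deleteVerts_iff.2 ⟨?_, ?_⟩⟩
  · simp only [Walk.toSubgraph_append, Walk.toSubgraph_reverse]
    exact sup_le (sup_le hp (hr.trans le_sup_left)) hq
  · simp only [Walk.mem_support_append_iff, Walk.support_reverse, List.mem_reverse]
    tauto

theorem isNonseparable_subgraphOfAdj (h : G.Adj u v) : (G.subgraphOfAdj h).IsNonseparable := by
  refine ⟨Subgraph.subgraphOfAdj_connected h, fun z hz =>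
    .mk (@Preconnected.of_subsingleton _ _ ?_)⟩
  rw [Set.subsingleton_coe]
  rintro x ⟨hx, hxz⟩ y ⟨hy, hyz⟩
  simp only [subgraphOfAdj_verts, Set.mem_insert_iff, Set.mem_singleton_iff] at hx hy hz hxz hyz
  grind

end Nonseparable

section Blocks

variable {V : Type*} {G H : SimpleGraph V} {A B : G.Subgraph} {u v : V}

theorem le_of_isBlock (hB : B.IsBlock) (h : (B ⊔ A).IsNonseparable) : A ≤ B :=
  le_sup_right.trans (hB.2 h le_sup_left)

theorem le_of_isBlock_of_mem_verts (hA : A.IsNonseparable) (hB : B.IsBlock) (huv : u ≠ v)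
    (huA : u ∈ A.verts) (hvA : v ∈ A.verts) (huB : u ∈ B.verts) (hvB : v ∈ B.verts) : A ≤ B := by
  refine le_of_isBlock hB (isNonseparable_sup hB.1 hA.1 ⟨u, huB, huA⟩ fun z x hx hxz => ?_)
  by_cases huz : u = z
  · exact ⟨v, hvB, exists_walk_of_isNonseparable hA hx hvA hxz (huz ▸ huv.symm)⟩
  · exact ⟨u, huB, exists_walk_of_isNonseparable hA hx huA hxz huz⟩

theorem isBlock_eq_of_mem_verts (hA : A.IsBlock) (hB : B.IsBlock) (huv : u ≠ v)
    (huA : u ∈ A.verts) (hvA : v ∈ A.verts) (huB : u ∈ B.verts) (hvB : v ∈ B.verts) : A = B :=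
  le_antisymm (le_of_isBlock_of_mem_verts hA.1 hB huv huA hvA huB hvB)
    (le_of_isBlock_of_mem_verts hB.1 hA huv huB hvB huA hvA)

theorem toSubgraph_le_of_isBlock (hB : B.IsBlock) (hu : u ∈ B.verts) (hv : v ∈ B.verts)
    {p : G.Walk u v} (hp : p.IsPath) : p.toSubgraph ≤ B := by
  refine le_of_isBlock hB (isNonseparable_sup hB.1 p.toSubgraph_connected
    ⟨u, hu, p.start_mem_verts_toSubgraph⟩ fun z x hx hxz => ?_)
  obtain ⟨q, r, -, -, rfl⟩ := hp.mem_support_iff_exists_append.1 (p.mem_verts_toSubgraph.1 hx)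
  rw [Walk.toSubgraph_append]
  by_cases hzq : z ∈ q.support
  · exact ⟨v, hv, r, le_sup_right, fun hzr => hp.ne_of_mem_support_of_append hxz.symm hzq hzr rfl⟩
  · exact ⟨u, hu, q.reverse, q.toSubgraph_reverse.trans_le le_sup_left, by simpa using hzq⟩

theorem exists_isBlock_adj [Finite V] (h : G.Adj u v) :
    ∃ B : G.Subgraph, B.IsBlock ∧ B.Adj u v := by
  obtain ⟨B, hle, hB⟩ : ∃ B : G.Subgraph, G.subgraphOfAdj h ≤ B ∧ B.IsBlock :=
    Set.Finite.exists_le_maximal (Set.toFinite _) (isNonseparable_subgraphOfAdj h)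
  exact ⟨B, hB, (subgraphOfAdj_le_iff h B).1 hle⟩

theorem nontrivial_verts_of_isBlock [Nontrivial V] (hG : G.Connected) (hB : B.IsBlock) :
    Nontrivial B.verts := by
  obtain ⟨u, hu⟩ := hB.1.1.nonempty
  by_contra h
  rw [not_nontrivial_iff_subsingleton, Set.subsingleton_coe] at h
  obtain ⟨v, huv⟩ := hG.preconnected.exists_adj_of_nontrivial u
  have hle : B ≤ G.subgraphOfAdj huv := by
    refine ⟨fun x hx => ?_, fun x y hxy => ?_⟩
    · simp [h hx hu]
    · exact absurd (h hxy.fst_mem hxy.snd_mem) hxy.ne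
  have hv : v ∈ B.verts := (hB.2 (isNonseparable_subgraphOfAdj huv) hle).1 (by simp)
  exact huv.ne (h hu hv)

/-- The part of `H` inside the subgraph `B` of `G`, as a graph on the vertices of `B`. -/
def restrict (H : SimpleGraph V) (B : G.Subgraph) : SimpleGraph B.verts :=
  (H ⊓ B.spanningCoe).comap (Function.Embedding.subtype (· ∈ B.verts))

theorem restrict_le (H : SimpleGraph V) (B : G.Subgraph) : restrict H B ≤ B.coe :=
  fun _ _ h => h.2

theorem restrict_self (B : G.Subgraph) : restrict G B = B.coe :=
  le_antisymm (restrict_le G B) fun _ _ h => ⟨B.adj_sub h, h⟩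

theorem map_restrict (H : SimpleGraph V) (B : G.Subgraph) :
    (restrict H B).map (Function.Embedding.subtype (· ∈ B.verts)) = H ⊓ B.spanningCoe := by
  refine le_antisymm (map_comap_le _ _) fun a b hab => ?_
  exact (SimpleGraph.map_adj _ _ _ _).2 ⟨⟨a, hab.2.fst_mem⟩, ⟨b, hab.2.snd_mem⟩, hab, rfl, rfl⟩

theorem isEdgeConnected_two_restrict (hB : B.IsBlock) (hHG : H ≤ G)
    (hH : H.IsEdgeConnected 2) : (restrict H B).IsEdgeConnected 2 := by
  intro x y
  rw [← isEdgeReachable_map_iff (.subtype (· ∈ B.verts)), map_restrict, isEdgeReachable_two]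
  intro e
  obtain ⟨p, hp⟩ := (isEdgeReachable_two.1 (hH x y) e).exists_isPath
  have hpB := toSubgraph_le_of_isBlock hB x.2 y.2 (hp.mapLe ((H.deleteEdges_le _).trans hHG))
  refine ⟨p.transfer _ fun d hd => ?_⟩
  have hdH := p.edges_subset_edgeSet hd
  have hdB : d ∈ B.edgeSet := Subgraph.edgeSet_mono hpB <| by
    rwa [Walk.mem_edges_toSubgraph, Walk.edges_mapLe_eq_edges]
  rw [edgeSet_deleteEdges] at hdH ⊢
  rw [SimpleGraph.edgeSet_inf]
  exact ⟨⟨hdH.1, hdB⟩, hdH.2⟩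

theorem isEdgeConnected_two_coe (hB : B.IsBlock) (hG : G.IsEdgeConnected 2) :
    B.coe.IsEdgeConnected 2 :=
  restrict_self B ▸ isEdgeConnected_two_restrict hB le_rfl hG

end Blocks

section Glue

variable {V : Type*} {G : SimpleGraph V} {ι : Type*} {B : ι → G.Subgraph} {k : ℕ}
  {K : ∀ i, SimpleGraph (B i).verts}

/-- The union of graphs `K i` on the vertex sets of the subgraphs `B i`. -/
def glue (K : ∀ i, SimpleGraph (B i).verts) : SimpleGraph V :=
  ⨆ i, (K i).map (Function.Embedding.subtype (· ∈ (B i).verts))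

theorem glue_le (hK : ∀ i, K i ≤ (B i).coe) : glue K ≤ G := by
  refine iSup_le fun i a b hab => ?_
  obtain ⟨x, y, h, rfl, rfl⟩ := (map_adj _ _ _ _).1 hab
  exact (B i).adj_sub (hK i h)

theorem isEdgeConnected_glue (hG : G.Preconnected)
    (hcover : ∀ {u v}, G.Adj u v → ∃ i, (B i).Adj u v) (hK : ∀ i, (K i).IsEdgeConnected k) :
    (glue K).IsEdgeConnected k := by
  intro u v
  obtain ⟨p⟩ := hG u v
  induction p with
  | nil => exact .rfl
  | cons h _ ih =>
    obtain ⟨i, hi⟩ := hcover h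
    have hstep := (isEdgeReachable_map_iff (.subtype (· ∈ (B i).verts))).2
      (hK i ⟨_, hi.fst_mem⟩ ⟨_, hi.snd_mem⟩)
    exact (hstep.mono (le_iSup (fun i => (K i).map _) i)).trans ih

theorem ncard_edgeSet_glue_le [Finite V] [Fintype ι] (K : ∀ i, SimpleGraph (B i).verts) :
    (glue K).edgeSet.ncard ≤ ∑ i, (K i).edgeSet.ncard := by
  rw [glue, edgeSet_iSup]
  refine (Set.ncard_iUnion_le_of_fintype _).trans (Finset.sum_le_sum fun i _ => ?_)
  rw [ncard_edgeSet_map]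

/-- Glue spanning trees of the `B i`: the result is connected, so has at least `|V| - 1` edges. -/
theorem card_add_card_le_sum_card_verts [Finite V] [Fintype ι] (hG : G.Connected)
    (hcover : ∀ {u v}, G.Adj u v → ∃ i, (B i).Adj u v) (hB : ∀ i, (B i).Connected) :
    Nat.card V + Fintype.card ι ≤ ∑ i, Nat.card (B i).verts + 1 := by
  have := hG.nonempty
  choose T _ hT using fun i => (hB i).coe.exists_isTree_le
  have hglue : (glue T).IsEdgeConnected 1 := isEdgeConnected_glue hG.preconnected hcover fun i =>
    isEdgeConnected_one.2 (hT i).connected.preconnected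
  have hverts := (hglue.connected one_ne_zero).card_vert_le_card_edgeSet_add_one
  have hedges := ncard_edgeSet_glue_le T
  have hsum : ∑ i, Nat.card (B i).verts = ∑ i, (T i).edgeSet.ncard + Fintype.card ι := by
    rw [← Finset.card_univ, Finset.card_eq_sum_ones, ← Finset.sum_add_distrib]
    exact Finset.sum_congr rfl fun i _ => (isTree_iff_connected_and_card.1 (hT i)).2.symm
  rw [Nat.card_coe_set_eq] at hverts
  omega

end Glue

section Subsingleton

variable {V : Type*} [Subsingleton V] {G : SimpleGraph V}

theorem mc_of_subsingleton (k : ℕ) (G : SimpleGraph V) : mc k G = 0 := by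
  have : IsEmpty G.edgeSet := by
    rw [Subsingleton.elim G ⊥, edgeSet_bot]
    infer_instance
  have hsub : mcColorCounts k G ⊆ {0} := by
    rintro m ⟨Γ, -, rfl⟩
    rw [Set.range_eq_empty, Set.ncard_empty, Set.mem_singleton_iff]
  rcases Set.subset_singleton_iff_eq.1 hsub with h | h <;> simp [mc, h]

theorem card_blocks_of_subsingleton [Nonempty V] {ι : Type*} [Fintype ι] {B : ι → G.Subgraph}
    (hinj : Function.Injective B)
    (hB : ∀ A : G.Subgraph, A.IsBlock ↔ ∃ i, B i = A) : Fintype.card ι = 1 := by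
  have htop {A : G.Subgraph} (hA : A.IsNonseparable) : A = ⊤ := by
    obtain ⟨w, hw⟩ := hA.1.nonempty
    refine top_unique ⟨fun v _ => ?_, fun u v huv => absurd (Subsingleton.elim u v) huv.ne⟩
    rwa [Subsingleton.elim v w]
  have hpre (A : G.Subgraph) : A.Preconnected := .mk Preconnected.of_subsingleton
  have hns : (⊤ : G.Subgraph).IsNonseparable :=
    ⟨Subgraph.connected_iff.2 ⟨hpre _, Set.univ_nonempty⟩, fun _ _ => hpre _⟩
  obtain ⟨i₀, hi₀⟩ := (hB ⊤).1 ⟨hns, fun _ _ _ => le_top⟩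
  refine Fintype.card_eq_one_iff.2 ⟨i₀, fun i => hinj ?_⟩
  rw [hi₀, htop ((hB _).2 ⟨i, rfl⟩).1]

end Subsingleton

section BlockDecomposition

variable {V : Type*} [Finite V] {G H : SimpleGraph V}

theorem card_le_minSpanningSize [Nontrivial V] (hG : G.IsEdgeConnected 2) :
    Nat.card V ≤ minSpanningSize G := by
  obtain ⟨H, -, hH, hcard⟩ := exists_ncard_edgeSet_eq_minSpanningSize hG
  obtain ⟨u, v, huv⟩ := exists_pair_ne V
  have huniv : {w | H.Reachable u w} = Set.univ :=
    Set.eq_univ_of_forall fun w => (hH u w).reachable two_ne_zero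
  rw [← hcard, ← Set.ncard_univ, ← huniv]
  exact ncard_reachable_le_of_isEdgeReachable_two huv (hH u v)

variable {ι : Type*} {B : ι → G.Subgraph}

theorem exists_adj_of_forall_isBlock_iff (hB : ∀ A : G.Subgraph, A.IsBlock ↔ ∃ i, B i = A)
    {u v : V} (h : G.Adj u v) : ∃ i, (B i).Adj u v := by
  obtain ⟨A, hA, hadj⟩ := exists_isBlock_adj h
  obtain ⟨i, rfl⟩ := (hB A).1 hA
  exact ⟨i, hadj⟩

variable [Fintype ι]

theorem ncard_edgeSet_eq_sum_restrict (hinj : Function.Injective B)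
    (hB : ∀ A : G.Subgraph, A.IsBlock ↔ ∃ i, B i = A) (hHG : H ≤ G) :
    H.edgeSet.ncard = ∑ i, (restrict H (B i)).edgeSet.ncard := by
  have hunion : H.edgeSet = ⋃ i, (H ⊓ (B i).spanningCoe).edgeSet := by
    refine Set.Subset.antisymm (Sym2.ind fun a b h => ?_)
      (Set.iUnion_subset fun i => edgeSet_mono inf_le_left)
    obtain ⟨i, hi⟩ := exists_adj_of_forall_isBlock_iff hB (hHG h)
    exact Set.mem_iUnion.2 ⟨i, h, hi⟩
  have hdisj : Pairwise fun i j =>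
      Disjoint (H ⊓ (B i).spanningCoe).edgeSet (H ⊓ (B j).spanningCoe).edgeSet := by
    refine fun i j hij => Set.disjoint_left.2 (Sym2.ind fun a b hi hj => hij (hinj ?_))
    have hBi : (B i).Adj a b := hi.2
    have hBj : (B j).Adj a b := hj.2
    exact isBlock_eq_of_mem_verts ((hB _).2 ⟨i, rfl⟩) ((hB _).2 ⟨j, rfl⟩) hBi.ne
      hBi.fst_mem hBi.snd_mem hBj.fst_mem hBj.snd_mem
  rw [hunion, Set.ncard_iUnion_of_finite (fun _ => Set.toFinite _) hdisj,
    finsum_eq_sum_of_fintype]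
  refine Finset.sum_congr rfl fun i _ => ?_
  rw [← map_restrict, ncard_edgeSet_map]

theorem minSpanningSize_eq_sum (hG : G.IsEdgeConnected 2) (hinj : Function.Injective B)
    (hB : ∀ A : G.Subgraph, A.IsBlock ↔ ∃ i, B i = A) :
    minSpanningSize G = ∑ i, minSpanningSize (B i).coe := by
  have hblock (i : ι) : (B i).IsBlock := (hB _).2 ⟨i, rfl⟩
  apply le_antisymm
  · choose K hKB hK hcard using fun i =>
      exists_ncard_edgeSet_eq_minSpanningSize (isEdgeConnected_two_coe (hblock i) hG)
    calc minSpanningSize G ≤ (glue K).edgeSet.ncard :=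
          minSpanningSize_le (glue_le hKB) <| isEdgeConnected_glue (hG.preconnected two_ne_zero)
            (exists_adj_of_forall_isBlock_iff hB) hK
      _ ≤ ∑ i, (K i).edgeSet.ncard := ncard_edgeSet_glue_le K
      _ = ∑ i, minSpanningSize (B i).coe := Finset.sum_congr rfl fun i _ => hcard i
  · obtain ⟨H, hHG, hH, hcard⟩ := exists_ncard_edgeSet_eq_minSpanningSize hG
    rw [← hcard, ncard_edgeSet_eq_sum_restrict hinj hB hHG]
    exact Finset.sum_le_sum fun i _ => minSpanningSize_le (restrict_le H (B i))
      (isEdgeConnected_two_restrict (hblock i) hHG hH)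

theorem mc_two_add_card_blocks [Nonempty V] (hG : G.IsEdgeConnected 2)
    (hinj : Function.Injective B) (hB : ∀ A : G.Subgraph, A.IsBlock ↔ ∃ i, B i = A) :
    mc 2 G + Fintype.card ι = ∑ i, mc 2 (B i).coe + 1 := by
  rcases subsingleton_or_nontrivial V with hV | hV
  · simp only [mc_of_subsingleton, card_blocks_of_subsingleton hinj hB, Finset.sum_const_zero]
  have hblock (i : ι) : (B i).IsBlock := (hB _).2 ⟨i, rfl⟩
  have hmcB : ∑ i, mc 2 (B i).coe + ∑ i, minSpanningSize (B i).coe =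
      ∑ i, (B i).coe.edgeSet.ncard + Fintype.card ι := by
    rw [← Finset.card_univ, Finset.card_eq_sum_ones, ← Finset.sum_add_distrib,
      ← Finset.sum_add_distrib]
    refine Finset.sum_congr rfl fun i _ => ?_
    have := nontrivial_verts_of_isBlock (hG.connected two_ne_zero) (hblock i)
    exact mc_two_add_minSpanningSize (isEdgeConnected_two_coe (hblock i) hG)
  have hedges := ncard_edgeSet_eq_sum_restrict hinj hB le_rfl
  simp only [restrict_self] at hedges
  have hmcG := mc_two_add_minSpanningSize hG
  rw [minSpanningSize_eq_sum hG hinj hB] at hmcG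
  omega

theorem mc_two_add_card_add_card_blocks_le [Nonempty V] (hG : G.IsEdgeConnected 2)
    (hinj : Function.Injective B) (hB : ∀ A : G.Subgraph, A.IsBlock ↔ ∃ i, B i = A) :
    mc 2 G + Nat.card V + Fintype.card ι ≤ G.edgeSet.ncard + 2 := by
  rcases subsingleton_or_nontrivial V with hV | hV
  · rw [mc_of_subsingleton, card_blocks_of_subsingleton hinj hB, Nat.card_unique]
    omega
  have hblock (i : ι) : (B i).IsBlock := (hB _).2 ⟨i, rfl⟩
  have hconn := hG.connected two_ne_zero
  have hcards : ∑ i, Nat.card (B i).verts ≤ ∑ i, minSpanningSize (B i).coe :=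
    Finset.sum_le_sum fun i _ => by
      have := nontrivial_verts_of_isBlock hconn (hblock i)
      exact card_le_minSpanningSize (isEdgeConnected_two_coe (hblock i) hG)
  have hverts := card_add_card_le_sum_card_verts hconn (exists_adj_of_forall_isBlock_iff hB)
    fun i => (hblock i).1.1
  have hmc := mc_two_add_minSpanningSize hG
  rw [minSpanningSize_eq_sum hG hinj hB] at hmc
  omega

end BlockDecomposition

end MonochromaticConnection

theorem corollary2p3 {V : Type*} [Finite V] [Nonempty V] (G : SimpleGraph V)
    (hG : G.IsEdgeConnected 2)
    (t : ℕ) (B : Fin t → G.Subgraph) (hB_inj : Function.Injective B)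
    (hB : ∀ H : G.Subgraph, H.IsBlock ↔ ∃ i, B i = H) :
    ((SimpleGraph.mcColorCounts 2 G).Nonempty ∧
      ∀ i, (SimpleGraph.mcColorCounts 2 (B i).coe).Nonempty) ∧
    (SimpleGraph.mc 2 G : ℤ) = (∑ i, (SimpleGraph.mc 2 (B i).coe : ℤ)) - t + 1 ∧
    (SimpleGraph.mc 2 G : ℤ) ≤ (G.edgeSet.ncard : ℤ) - Nat.card V - t + 2 := by
  have hblock (i : Fin t) : (B i).IsBlock := (hB _).2 ⟨i, rfl⟩
  have hsum := MonochromaticConnection.mc_two_add_card_blocks hG hB_inj hB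
  have hle := MonochromaticConnection.mc_two_add_card_add_card_blocks_le hG hB_inj hB
  rw [Fintype.card_fin] at hsum hle
  refine ⟨⟨MonochromaticConnection.mcColorCounts_two_nonempty hG, fun i =>
    MonochromaticConnection.mcColorCounts_two_nonempty
      (MonochromaticConnection.isEdgeConnected_two_coe (hblock i) hG)⟩, ?_⟩
  rw [← Nat.cast_sum]
  constructor <;> omega
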